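/- Let $W=(W^1,W^2)$ be a standard two-dimensional Brownian motion on $(\Omega,\mathcal F,P)$ with continuous paths, generating the filtration $(\mathcal F_t)_{t\ge 0}$. Let $r,\mu_1,\mu_2,\delta\in\mathbb R$, $\sigma_1,\sigma_2,\gamma,L,s_0,v>0$, $|\rho|<1$ and $\delta>-\sigma_2^2/2$ (for instance any dividend rate $\delta\ge 0$). Consider the discounted prices $$dS_t=(\mu_1-r)S_t\,dt+\sigma_1S_t\,dW^1_t,\quad S_0=s_0,\qquad dV_t=(\mu_2-r)V_t\,dt+\sigma_2V_t\bigl(\rho\,dW^1_t+\sqrt{1-\rho^2}\,dW^2_t\bigr),\quad V_0=v,$$ that is, the corresponding geometric Brownian motions, where $t$ is the time elapsed since the loan was granted and $V$ pays dividends at the rate $\delta$. Assume the CAPM condition $$\frac{\mu_2+\delta-r}{\sigma_2}=\rho\,\frac{\mu_1-r}{\sigma_1}.$$ Let $Q$ be the risk-neutral measure: a probability measure, equivalent to $P$ on $\mathcal F_t$ for every $t<\infty$, under which $S_t$ and $e^{\delta t}V_t$ (the discounted value of the asset with dividends reinvested) are $(\mathcal F_t)$-martingales. Put $\beta=1-\frac{2}{\sigma_2}\left(\frac{\mu_2-r}{\sigma_2}-\rho\frac{\mu_1-r}{\sigma_1}\right)$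 and let $V^*>L$ be the solution of $$V^*-L=\frac{1}{\gamma(1-\rho^2)}\log\left[1+\frac{\gamma(1-\rho^2)V^*}{\beta}\right].$$ A borrower with risk aversion $\gamma$ has a loan of infinite maturity with interest rate $\alpha=r$: by paying $e^{\alpha t}L$ at any time $t$ he receives an asset worth $e^{rt}V_t$. He repays as soon as $V$ is at or above $V^*$, i.e. at $\tau=\inf\{t\ge0: V_t\ge V^*\}$ (immediately if $v\ge V^*$). The cost of this option for the bank is $$C(v)=\mathbb E^Q\left[e^{-r\tau}\bigl(e^{r\tau}V_\tau-e^{\alpha\tau}L\bigr)^+\mathbf 1_{\{\tau<\infty\}}\right].$$ Then: 1. $\beta=1+2\delta/\sigma_2^2>0$. 2. Under $Q$, $V$ is a geometric Brownian motion with drift $-\delta$ and volatility $\sigma_2$ started at $v$: $V_t=v\exp\bigl((-\delta-\sigma_2^2/2)t+\sigma_2W^Q_t\bigr)$ for a $Q$-Brownian motion $W^Q$. 3. The expectation defining $C(v)$ is that of a $Q$-integrable random variable. 4. If $v<V^*$ and $\tau^*=\inf\{t\ge 0: V_t=V^*\}$, then $Q(\tau^*<\infty)=(v/V^*)^\beta$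 and $$C(v)=(V^*-L)\,Q(\tau^*<\infty)=(V^*-L)\left(\frac{v}{V^*}\right)^{\beta}.$$ 5. If $v\ge V^*$, then $C(v)=v-L$. -/

import Mathlib

open MeasureTheory ProbabilityTheory
open scoped NNReal

/-- `W₁, W₂` are the two coordinates of a standard two-dimensional Brownian motion under `P`:
two independent standard real Brownian motions. All paths are taken to be continuous: on an
infinite horizon the measures considered below are equivalent to `P` only on finite time
intervals, so a merely `P`-almost sure continuity would not transfer to them. -/
structure IsStandardBrownianPair {Ω : Type*} [MeasurableSpace Ω] (W₁ W₂ : ℝ≥0 → Ω → ℝ)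
    (P : Measure Ω) : Prop where
  brownian₁ : IsBrownianReal W₁ P
  brownian₂ : IsBrownianReal W₂ P
  indep : IndepFun (fun ω t => W₁ t ω) (fun ω t => W₂ t ω) P
  measurable₁ : ∀ t, Measurable (W₁ t)
  measurable₂ : ∀ t, Measurable (W₂ t)
  continuous₁ : ∀ ω, Continuous fun t => W₁ t ω
  continuous₂ : ∀ ω, Continuous fun t => W₂ t ω

/-- The filtration generated by the pair `(W₁, W₂)`. -/
noncomputable def pairFiltration {Ω : Type*} [mΩ : MeasurableSpace Ω] (W₁ W₂ : ℝ≥0 → Ω → ℝ)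
    (h₁ : ∀ t, Measurable (W₁ t)) (h₂ : ∀ t, Measurable (W₂ t)) : Filtration ℝ≥0 mΩ :=
  Filtration.natural (fun t ω => (W₁ t ω, W₂ t ω))
    (fun t => ((h₁ t).prodMk (h₂ t)).stronglyMeasurable)

/-- The geometric Brownian motion started at `x₀` with drift `m` and volatility `σ` driven by `B`,
i.e. the solution `X_t = x₀ exp ((m - σ² / 2) t + σ B_t)` of `dX_t = m X_t dt + σ X_t dB_t`. -/
noncomputable def geometricBM {Ω : Type*} (x₀ m σ : ℝ) (B : ℝ≥0 → Ω → ℝ) : ℝ≥0 → Ω → ℝ :=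
  fun t ω => x₀ * Real.exp ((m - σ ^ 2 / 2) * (t : ℝ) + σ * B t ω)

/-- `Q` is a risk-neutral (equivalent martingale) measure on the infinite horizon for the market
with discounted prices `S` (paying no dividends) and `V` (paying dividends at the rate `δ`):
it is a probability measure, it is equivalent to `P` on the information up to any finite time, and
the discounted values of the two investments, with the dividends of `V` reinvested in `V`,
are martingales. -/
structure IsRiskNeutral {Ω : Type*} [mΩ : MeasurableSpace Ω] (𝓕 : Filtration ℝ≥0 mΩ)
    (P Q : Measure Ω) (S V : ℝ≥0 → Ω → ℝ) (δ : ℝ) : Prop where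
  isProbabilityMeasure : IsProbabilityMeasure Q
  absolutelyContinuous : ∀ t, Q.trim (𝓕.le t) ≪ P.trim (𝓕.le t)
  absolutelyContinuous' : ∀ t, P.trim (𝓕.le t) ≪ Q.trim (𝓕.le t)
  martingale_fst : Martingale S 𝓕 Q
  martingale_snd : Martingale (fun (t : ℝ≥0) ω => Real.exp (δ * (t : ℝ)) * V t ω) 𝓕 Q

/-- The exponent `β = 1 - (2 / σ₂) ((μ₂ - r) / σ₂ - ρ (μ₁ - r) / σ₁)`. -/
noncomputable def repaymentExponent (r μ₁ μ₂ σ₁ σ₂ ρ : ℝ) : ℝ :=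
  1 - 2 / σ₂ * ((μ₂ - r) / σ₂ - ρ * ((μ₁ - r) / σ₁))

/-- `b` is the optimal repayment threshold of a borrower with risk aversion `γ`: the solution
`b > L` of `b - L = log (1 + γ (1 - ρ²) b / β) / (γ (1 - ρ²))`. -/
def IsRepaymentThreshold (L γ ρ β b : ℝ) : Prop :=
  L < b ∧
    b - L = 1 / (γ * (1 - ρ ^ 2)) * Real.log (1 + γ * (1 - ρ ^ 2) * b / β)

/-- The borrower repays as soon as the discounted collateral value `V` is at or above `b`
(`⊤` if that never happens). -/
noncomputable def repaymentTime {Ω : Type*} (V : ℝ≥0 → Ω → ℝ) (b : ℝ) : Ω → WithTop ℝ≥0 :=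
  hittingAfter V (Set.Ici b) 0

/-- The discounted payoff of repaying at time `t`: an asset worth `e^{rt} V_t` is obtained for
the amount `e^{αt} L`. -/
noncomputable def discountedPayoff {Ω : Type*} (r α L : ℝ) (V : ℝ≥0 → Ω → ℝ) : ℝ≥0 → Ω → ℝ :=
  fun t ω => Real.exp (-r * (t : ℝ)) *
    max (Real.exp (r * (t : ℝ)) * V t ω - Real.exp (α * (t : ℝ)) * L) 0

/-- The cost for the bank of the perpetual option to repay, exercised at the random time `τ`: the
`Q`-expectation of the discounted payoff at `τ` on the event `τ < ∞`. -/
noncomputable def repaymentOptionCost {Ω : Type*} [MeasurableSpace Ω] (Q : Measure Ω)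
    (r α L : ℝ) (V : ℝ≥0 → Ω → ℝ) (τ : Ω → WithTop ℝ≥0) : ℝ :=
  ∫ ω in {ω | τ ω < ⊤}, stoppedValue (discountedPayoff r α L V) τ ω ∂Q

open Filter Topology

/-! Write W = ρW¹ + √(1-ρ²)W², a P-Brownian motion, and B_t = W_t + (μ₂-r+δ)t/σ₂. Then e^{δt}V_t = v
exp(σ₂B_t - σ₂²t/2), so Q makes this one exponential of B a martingale and is absolutely continuous
with respect to P up to any finite time. By Lévy's characterization
(`HasBrownianIncrements.of_martingale_expProcess`) this already forces B to be a Q-Brownian motion.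

Lévy's characterization is obtained by discretization. Along fine grids the sums of squared
increments of B converge to the elapsed time in P-probability, hence in Q-probability. A second
order expansion writes each step d of B over time h, seen through exp(ilB + l²t/2), as a predictable
multiple of a step of the exponential martingale, a multiple of d² - h, and terms of order h^{3/2}.
The first kind has zero Q-mean; the others vanish in Q-probability when summed. As the increments
have no a priori moment bounds under Q, the sums are stopped when the path ceases to be moderate
(`ModerateUpTo`). The stopped sums are dominated by a constant plus the effect of one large step,
which the terminal value of the martingale controls (`integral_jump_le`). In the limit,
E^Q[exp(il(B_{s+T}-B_s)); A] = Q(A)e^{-l²T/2} for past events A (`setIntegral_cexp_increment`).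

The exponent β is the one for which V^β is driftless: V^β = v^β exp(βσ₂B - (βσ₂)²t/2). A nonnegative
continuous martingale N that starts below y and vanishes at infinity reaches y with probability
E[N₀]/y (`IsPathContinuousMartingale.measureReal_exists_eq`): Doob's maximal inequality gives one
bound, optional stopping on grids with vanishing overshoot the other. With y = (V*)^β this is the
passage probability. Since α = r, the discounted payoff is V - L; by continuity it is the constant
V* - L at a passage from below, and v - L at time zero otherwise. The cost is this constant times
the probability of repayment. -/

/-! ### Second order expansion of a single step -/

/-- Bound for the remainder of a second order expansion in an increment `d` over a time step `h`. -/
noncomputable def stepError (d h : ℝ) : ℝ := |d| ^ 3 + h * |d| + h ^ 2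

lemma stepError_nonneg {d h : ℝ} (hh : 0 ≤ h) : 0 ≤ stepError d h := by
  unfold stepError; positivity

lemma stepError_le {d h : ℝ} (hd : |d| ≤ 1) (hh : 0 ≤ h) (hh1 : h ≤ 1) :
    stepError d h ≤ d ^ 2 + 2 * h := by
  unfold stepError
  have h1 : |d| ^ 3 ≤ d ^ 2 := by
    rw [← sq_abs d, pow_succ]
    exact mul_le_of_le_one_right (by positivity) hd
  have h2 : h * |d| ≤ h := mul_le_of_le_one_right hh hd
  have h3 : h ^ 2 ≤ h := by rw [sq]; exact mul_le_of_le_one_right hh hh1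
  linarith

/-- In the Brownian scaling |d| ~ √h the terms kept are of order at most h. What is dropped, namely
the cubic tail of the exponential and the parts d h and h² of the square, is of order h^{3/2}, which
is the size of `stepError`. -/
lemma exists_norm_exp_sub_quadratic_le (p q : ℂ) : ∃ C : ℝ, 0 ≤ C ∧ ∀ d h : ℝ, |d| ≤ 1 → 0 ≤ h →
    h ≤ 1 → ‖Complex.exp (p * d + q * h) - (1 + p * d + q * h + p ^ 2 * d ^ 2 / 2)‖
      ≤ C * stepError d h := by
  set a := ‖p‖
  set b := ‖q‖
  have ha : 0 ≤ a := norm_nonneg _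
  have hb : 0 ≤ b := norm_nonneg _
  refine ⟨(a + b) ^ 3 * Real.exp (a + b) + a * b + b ^ 2, by positivity, fun d h hd hh hh1 => ?_⟩
  set z : ℂ := p * d + q * h with hz
  have hzn : ‖z‖ ≤ a * |d| + b * h := by
    refine (norm_add_le _ _).trans (le_of_eq ?_)
    simp [a, b, abs_of_nonneg hh]
  have hz1 : ‖z‖ ≤ a + b := hzn.trans (add_le_add (mul_le_of_le_one_right ha hd)
    (mul_le_of_le_one_right hb hh1))
  -- Both |d| and h are compared with their maximum, whose cube is either |d|³ or h³ ≤ h².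
  have hz3 : ‖z‖ ^ 3 ≤ (a + b) ^ 3 * (|d| ^ 3 + h ^ 2) := by
    have hm : ‖z‖ ≤ (a + b) * max |d| h := by
      refine hzn.trans ?_
      rw [add_mul]
      gcongr
      · exact le_max_left _ _
      · exact le_max_right _ _
    refine (pow_le_pow_left₀ (norm_nonneg _) hm 3).trans ?_
    rw [mul_pow]
    gcongr
    have h3 : h ^ 3 ≤ h ^ 2 := pow_le_pow_of_le_one hh hh1 (by norm_num)
    rcases le_total |d| h with hle | hle
    · rw [max_eq_right hle]; have : 0 ≤ |d| ^ 3 := by positivity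
      linarith
    · rw [max_eq_left hle]; nlinarith
  have h1 := Complex.norm_exp_sub_sum_le_norm_mul_exp z 3
  have h2 : ∑ m ∈ Finset.range 3, z ^ m / (m.factorial : ℂ) = 1 + z + z ^ 2 / 2 := by
    simp [Finset.sum_range_succ, Nat.factorial]
  rw [h2] at h1
  have h3 : Complex.exp z - (1 + p * d + q * h + p ^ 2 * d ^ 2 / 2)
      = (Complex.exp z - (1 + z + z ^ 2 / 2)) + (p * q * (d * h : ℝ) + q ^ 2 / 2 * (h ^ 2 : ℝ)) := by
    rw [hz]; push_cast; ring
  rw [h3]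
  have h4 : ‖p * q * ((d * h : ℝ) : ℂ) + q ^ 2 / 2 * ((h ^ 2 : ℝ) : ℂ)‖
      ≤ a * b * (h * |d|) + b ^ 2 / 2 * h ^ 2 := by
    refine (norm_add_le _ _).trans (le_of_eq ?_)
    simp only [norm_mul, Complex.norm_real, Real.norm_eq_abs, norm_div, norm_pow,
      abs_of_nonneg hh, RCLike.norm_ofNat]
    ring
  have h5 : ‖z‖ ^ 3 * Real.exp ‖z‖ ≤ (a + b) ^ 3 * (|d| ^ 3 + h ^ 2) * Real.exp (a + b) := by
    gcongr
  refine (norm_add_le _ _).trans ((add_le_add (h1.trans h5) h4).trans ?_)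
  unfold stepError
  have e1 : 0 ≤ |d| ^ 3 := by positivity
  have e2 : 0 ≤ h * |d| := by positivity
  have e3 : 0 ≤ h ^ 2 := by positivity
  have e4 : 0 ≤ (a + b) ^ 3 * Real.exp (a + b) := by positivity
  have e5 : 0 ≤ a * b := by positivity
  have e6 : 0 ≤ b ^ 2 := by positivity
  nlinarith [mul_nonneg e4 e2, mul_nonneg e5 e1, mul_nonneg e5 e3, mul_nonneg e6 e1,
    mul_nonneg e6 e2, mul_nonneg e6 e3]

/-- The part of one step of `exp (i l x + l² t / 2)` which is left after subtracting the
matching multiple of the step of the exponential martingale `exp (s x - s² t / 2)`. -/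
noncomputable def stepRemainder (l s d h : ℝ) : ℂ :=
  Complex.exp (Complex.I * l * d + (l ^ 2 / 2 : ℝ) * h) - 1
    - Complex.I * l / s * ((Real.exp (s * d - s ^ 2 / 2 * h) - 1 : ℝ) : ℂ)

/-- A discrete Itô formula: the factor il/s cancels the terms linear in d, and the remaining second
order terms combine into a multiple of d² - h with coefficient -(l² + ils)/2. -/
lemma exists_norm_stepRemainder_sub_le (l : ℝ) {s : ℝ} (hs : 0 < s) :
    ∃ C : ℝ, 0 ≤ C ∧ ∀ d h : ℝ, |d| ≤ 1 → 0 ≤ h → h ≤ 1 →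
      ‖stepRemainder l s d h - (-(l ^ 2 + Complex.I * l * s) / 2) * ((d ^ 2 - h : ℝ) : ℂ)‖
        ≤ C * stepError d h := by
  obtain ⟨C₁, hC₁, h₁⟩ := exists_norm_exp_sub_quadratic_le (Complex.I * l) ((l ^ 2 / 2 : ℝ) : ℂ)
  obtain ⟨C₂, hC₂, h₂⟩ := exists_norm_exp_sub_quadratic_le (s : ℂ) ((-(s ^ 2 / 2) : ℝ) : ℂ)
  refine ⟨C₁ + ‖Complex.I * l / s‖ * C₂, by positivity, fun d h hd hh hh1 => ?_⟩
  have key : stepRemainder l s d h - (-(l ^ 2 + Complex.I * l * s) / 2) * ((d ^ 2 - h : ℝ) : ℂ)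
      = (Complex.exp (Complex.I * l * d + (l ^ 2 / 2 : ℝ) * h)
          - (1 + Complex.I * l * d + (l ^ 2 / 2 : ℝ) * h + (Complex.I * l) ^ 2 * d ^ 2 / 2))
        - Complex.I * l / s * (Complex.exp (s * d + (-(s ^ 2 / 2) : ℝ) * h)
          - (1 + s * d + (-(s ^ 2 / 2) : ℝ) * h + (s : ℂ) ^ 2 * d ^ 2 / 2)) := by
    have hs' : (s : ℂ) ≠ 0 := by exact_mod_cast hs.ne'
    have he : ((Real.exp (s * d - s ^ 2 / 2 * h) - 1 : ℝ) : ℂ)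
        = Complex.exp (s * d + (-(s ^ 2 / 2) : ℝ) * h) - 1 := by
      push_cast; congr 2; ring
    unfold stepRemainder
    rw [he]
    push_cast
    field_simp
    ring_nf
    simp only [Complex.I_sq]
    ring
  rw [key]
  refine (norm_sub_le _ _).trans ?_
  rw [norm_mul]
  linear_combination h₁ d h hd hh hh1
    + mul_le_mul_of_nonneg_left (h₂ d h hd hh hh1) (norm_nonneg (Complex.I * l / s : ℂ))

/-- A crude bound without restriction on d, needed for the one large step that ends the moderate
part of a path. -/
lemma exists_norm_stepRemainder_le (l : ℝ) (s : ℝ) :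
    ∃ C : ℝ, 0 ≤ C ∧ ∀ d h : ℝ, 0 ≤ h → h ≤ 1 →
      ‖stepRemainder l s d h‖ ≤ C * (1 + Real.exp (s * d - s ^ 2 / 2 * h)) := by
  refine ⟨Real.exp (l ^ 2 / 2) + 1 + ‖Complex.I * l / s‖, by positivity, fun d h hh hh1 => ?_⟩
  unfold stepRemainder
  have h1 : ‖Complex.exp (Complex.I * l * d + (l ^ 2 / 2 : ℝ) * h)‖ ≤ Real.exp (l ^ 2 / 2) := by
    rw [Complex.norm_exp]
    have : (Complex.I * l * d + (l ^ 2 / 2 : ℝ) * h : ℂ).re = l ^ 2 / 2 * h := by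
      rw [Complex.add_re, ← Complex.ofReal_mul, Complex.ofReal_re]; simp
    rw [this]
    gcongr
    exact mul_le_of_le_one_right (by positivity) hh1
  set E := Real.exp (s * d - s ^ 2 / 2 * h)
  have hE : 0 ≤ E := (Real.exp_pos _).le
  have h2 : ‖((E - 1 : ℝ) : ℂ)‖ ≤ 1 + E := by
    rw [Complex.norm_real, Real.norm_eq_abs, abs_le]; constructor <;> linarith
  refine (norm_sub_le _ _).trans ?_
  rw [norm_mul]
  have h3 := norm_sub_le (Complex.exp (Complex.I * l * d + (l ^ 2 / 2 : ℝ) * h)) 1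
  rw [norm_one] at h3
  have h4 := mul_le_mul_of_nonneg_left h2 (norm_nonneg (Complex.I * l / s : ℂ))
  have h5 : 0 ≤ Real.exp (l ^ 2 / 2) := (Real.exp_pos _).le
  nlinarith [mul_nonneg h5 hE]

/-! ### Discrete paths stopped when they cease to be moderate -/

/-- The discrete path `x` has stayed moderate up to step `k`: it is bounded by `K`, its increments
are at most one and its quadratic variation is at most `T + 1`. -/
def ModerateUpTo (K T : ℝ) (x : ℕ → ℝ) (k : ℕ) : Prop :=
  (∀ j ≤ k, |x j| ≤ K) ∧ (∀ j < k, |x (j + 1) - x j| ≤ 1) ∧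
    ∑ j ∈ Finset.range k, (x (j + 1) - x j) ^ 2 ≤ T + 1

lemma ModerateUpTo.mono {K T : ℝ} {x : ℕ → ℝ} {j k : ℕ} (h : ModerateUpTo K T x k) (hjk : j ≤ k) :
    ModerateUpTo K T x j :=
  ⟨fun i hi => h.1 i (hi.trans hjk), fun i hi => h.2.1 i (hi.trans_le hjk),
    (Finset.sum_le_sum_of_subset_of_nonneg (Finset.range_mono hjk)
      fun _ _ _ => sq_nonneg _).trans h.2.2⟩

open scoped Classical in
/-- The indicator of `ModerateUpTo`. -/
noncomputable def moderateIndicator (K T : ℝ) (x : ℕ → ℝ) (k : ℕ) : ℝ :=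
  if ModerateUpTo K T x k then 1 else 0

open scoped Classical in
/-- The indicator of a first large step after a moderate past. -/
noncomputable def jumpIndicator (K T : ℝ) (x : ℕ → ℝ) (k : ℕ) : ℝ :=
  if ModerateUpTo K T x k ∧ 1 < |x (k + 1) - x k| then 1 else 0

/-- The process `exp (i l (x - x₀) + l² t / 2)` along a discrete path `x` with time step `h`. -/
noncomputable def phaseFactor (l h : ℝ) (x : ℕ → ℝ) (k : ℕ) : ℂ :=
  Complex.exp (Complex.I * l * ((x k - x 0 : ℝ) : ℂ) + (l ^ 2 / 2 : ℝ) * ((k * h : ℝ) : ℂ))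

lemma norm_phaseFactor (l h : ℝ) (x : ℕ → ℝ) (k : ℕ) :
    ‖phaseFactor l h x k‖ = Real.exp (l ^ 2 / 2 * (k * h)) := by
  rw [phaseFactor, Complex.norm_exp]
  congr 1
  rw [Complex.add_re, ← Complex.ofReal_mul, Complex.ofReal_re]
  simp

lemma norm_phaseFactor_le (l : ℝ) {h T : ℝ} (hh : 0 ≤ h) {n k : ℕ} (hT : n * h = T) (hk : k ≤ n)
    (x : ℕ → ℝ) : ‖phaseFactor l h x k‖ ≤ Real.exp (l ^ 2 / 2 * T) := by
  rw [norm_phaseFactor, ← hT]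
  gcongr

lemma phaseFactor_zero (l h : ℝ) (x : ℕ → ℝ) : phaseFactor l h x 0 = 1 := by
  simp [phaseFactor]

lemma phaseFactor_succ_sub (l s h : ℝ) (x : ℕ → ℝ) (k : ℕ) :
    phaseFactor l h x (k + 1) - phaseFactor l h x k = phaseFactor l h x k *
      (stepRemainder l s (x (k + 1) - x k) h
        + Complex.I * l / s * ((Real.exp (s * (x (k + 1) - x k) - s ^ 2 / 2 * h) - 1 : ℝ) : ℂ)) := by
  have : phaseFactor l h x (k + 1) = phaseFactor l h x k *
      Complex.exp (Complex.I * l * ((x (k + 1) - x k : ℝ) : ℂ) + (l ^ 2 / 2 : ℝ) * h) := by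
    rw [phaseFactor, phaseFactor, ← Complex.exp_add]
    congr 1
    push_cast
    ring
  rw [this, stepRemainder]
  push_cast
  ring

/-- Being moderate is inherited by earlier indices, so the weighted sum telescopes to M stopped at
j, the first index where moderateness fails, or n. -/
lemma exists_sum_moderate_mul_sub_eq (K T : ℝ) (x : ℕ → ℝ) (M : ℕ → ℂ) (n : ℕ) :
    ∃ j ≤ n, ∑ k ∈ Finset.range n, (moderateIndicator K T x k : ℂ) * (M (k + 1) - M k) = M j - M 0 ∧
      (ModerateUpTo K T x n → j = n) := by
  induction n with
  | zero => exact ⟨0, le_rfl, by simp, fun _ => rfl⟩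
  | succ n ih =>
    obtain ⟨j, hj, hs, hg⟩ := ih
    rw [Finset.sum_range_succ, hs]
    by_cases h : ModerateUpTo K T x n
    · refine ⟨n + 1, le_rfl, ?_, fun _ => rfl⟩
      rw [hg h]
      simp [moderateIndicator, h]
    · refine ⟨j, hj.trans (Nat.le_succ n), by simp [moderateIndicator, h], fun h' => ?_⟩
      exact absurd (h'.mono (Nat.le_succ n)) h

/-- Up to the last moderate index the quadratic variation is at most T + 1. One further step may
still be counted, and as jumps are removed it adds at most 1. -/
lemma sum_moderate_sub_jump_mul_sq_le (K : ℝ) {T : ℝ} (x : ℕ → ℝ) (n : ℕ) (hT : 0 ≤ T) :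
    ∑ k ∈ Finset.range n, (moderateIndicator K T x k - jumpIndicator K T x k)
      * (x (k + 1) - x k) ^ 2 ≤ T + 2 := by
  have hle : ∀ k, moderateIndicator K T x k - jumpIndicator K T x k ≤ 1 := fun k => by
    unfold moderateIndicator jumpIndicator; split_ifs <;> norm_num
  induction n with
  | zero => simp; linarith
  | succ n ih =>
    rw [Finset.sum_range_succ]
    by_cases h : ModerateUpTo K T x n
    · have h1 : ∑ k ∈ Finset.range n, (moderateIndicator K T x k - jumpIndicator K T x k)
          * (x (k + 1) - x k) ^ 2 ≤ T + 1 :=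
        (Finset.sum_le_sum fun k _ => mul_le_of_le_one_left (sq_nonneg _) (hle k)).trans h.2.2
      have h2 : (moderateIndicator K T x n - jumpIndicator K T x n) * (x (n + 1) - x n) ^ 2 ≤ 1 := by
        by_cases hd : 1 < |x (n + 1) - x n|
        · simp [moderateIndicator, jumpIndicator, h, hd]
        · have := not_lt.1 hd
          simp only [moderateIndicator, jumpIndicator, h, hd, if_true, if_false, and_false]
          rw [← sq_abs]
          nlinarith [abs_nonneg (x (n + 1) - x n)]
      linarith
    · simpa [moderateIndicator, jumpIndicator, h] using ih

/-- The phase process is, up to a controlled error, a discrete stochastic integral against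
the exponential martingale. -/
theorem exists_norm_phaseFactor_sub_integral_le (l : ℝ) {s T : ℝ} (hs : 0 < s) (hT : 0 ≤ T) :
    ∃ C : ℝ, 0 ≤ C ∧ ∀ (K h : ℝ) (n : ℕ) (x : ℕ → ℝ), 0 ≤ h → h ≤ 1 → n * h = T →
      let rest := phaseFactor l h x n - 1 - ∑ k ∈ Finset.range n, (moderateIndicator K T x k : ℂ) *
        (phaseFactor l h x k * (Complex.I * l / s *
          ((Real.exp (s * (x (k + 1) - x k) - s ^ 2 / 2 * h) - 1 : ℝ) : ℂ)))
      ‖rest‖ ≤ C * (1 + ∑ k ∈ Finset.range n, jumpIndicator K T x k *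
          (1 + Real.exp (s * (x (k + 1) - x k) - s ^ 2 / 2 * h))) ∧
      (ModerateUpTo K T x n → ‖rest‖ ≤ C * (
        ‖∑ k ∈ Finset.range n, (moderateIndicator K T x k : ℂ) *
          (phaseFactor l h x k * (((x (k + 1) - x k) ^ 2 - h : ℝ) : ℂ))‖
        + ∑ k ∈ Finset.range n, stepError (x (k + 1) - x k) h)) := by
  obtain ⟨C₁, hC₁, h₁⟩ := exists_norm_stepRemainder_sub_le l hs
  obtain ⟨C₂, hC₂, h₂⟩ := exists_norm_stepRemainder_le l s
  set E := Real.exp (l ^ 2 / 2 * T) with hE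
  have hE0 : 0 ≤ E := (Real.exp_pos _).le
  set a : ℂ := -(l ^ 2 + Complex.I * l * s) / 2 with ha
  set C₃ := ‖a‖ + 2 * C₁ with hC₃
  have hC₃0 : 0 ≤ C₃ := by positivity
  -- For small steps the remainder is of order d² + h, whose sum is bounded pathwise while the path
  -- is moderate.
  have h₃ : ∀ d h : ℝ, |d| ≤ 1 → 0 ≤ h → h ≤ 1 → ‖stepRemainder l s d h‖ ≤ C₃ * (d ^ 2 + h) := by
    intro d h hd hh hh1
    have e1 := h₁ d h hd hh hh1
    have e2 := stepError_le hd hh hh1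
    have e3 : ‖a * ((d ^ 2 - h : ℝ) : ℂ)‖ ≤ ‖a‖ * (d ^ 2 + h) := by
      rw [norm_mul, Complex.norm_real, Real.norm_eq_abs]
      gcongr
      rw [abs_le]
      constructor <;> nlinarith [sq_nonneg d]
    have e4 := norm_sub_norm_le (stepRemainder l s d h) (a * ((d ^ 2 - h : ℝ) : ℂ))
    have e5 := mul_le_mul_of_nonneg_left e2 hC₁
    nlinarith [mul_nonneg hC₁ (sq_nonneg d), mul_nonneg hC₁ hh]
  -- One constant for both bounds: 2E pays for the stopped endpoint, E C₂ for the jump, E C₃ (2T +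
  -- 2) for quadratic variation T + 2 plus time T, and E C₁ + ‖a‖ for the moderate case.
  refine ⟨2 * E + E * (C₂ + C₃ * (2 * T + 2) + C₁) + ‖a‖, by positivity, ?_⟩
  intro K h n x hh hh1 hnT
  set M := phaseFactor l h x with hM
  have hMn : ∀ k ≤ n, ‖M k‖ ≤ E := fun k hk => norm_phaseFactor_le l hh hnT hk x
  set R := fun k => stepRemainder l s (x (k + 1) - x k) h with hR
  intro rest
  -- The first bracket is what the phase process does after being stopped; it vanishes on moderate
  -- paths.
  have hrest : rest = (M n - M 0 - ∑ k ∈ Finset.range n, (moderateIndicator K T x k : ℂ) *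
      (M (k + 1) - M k)) + ∑ k ∈ Finset.range n, (moderateIndicator K T x k : ℂ) * (M k * R k) := by
    have : ∀ k, (moderateIndicator K T x k : ℂ) * (M (k + 1) - M k)
        = (moderateIndicator K T x k : ℂ) * (M k * R k) + (moderateIndicator K T x k : ℂ) *
        (M k * (Complex.I * l / s *
          ((Real.exp (s * (x (k + 1) - x k) - s ^ 2 / 2 * h) - 1 : ℝ) : ℂ))) := by
      intro k
      rw [hM, phaseFactor_succ_sub l s h x k]
      ring
    simp_rw [this, Finset.sum_add_distrib]
    simp only [rest, hM, phaseFactor_zero]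
    ring
  obtain ⟨j, hj, hsum, hjn⟩ := exists_sum_moderate_mul_sub_eq K T x M n
  rw [hsum] at hrest
  have hfirst : ‖M n - M 0 - (M j - M 0)‖ ≤ 2 * E := by
    have : M n - M 0 - (M j - M 0) = M n - M j := by ring
    rw [this]
    linarith [norm_sub_le (M n) (M j), hMn n le_rfl, hMn j hj]
  constructor
  · have hterm : ∀ k ∈ Finset.range n, ‖(moderateIndicator K T x k : ℂ) * (M k * R k)‖
        ≤ E * (C₃ * ((moderateIndicator K T x k - jumpIndicator K T x k) * (x (k + 1) - x k) ^ 2 + h)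
          + C₂ * (jumpIndicator K T x k *
            (1 + Real.exp (s * (x (k + 1) - x k) - s ^ 2 / 2 * h)))) := by
      intro k hk
      have hk' := hMn k (Finset.mem_range.1 hk).le
      have hEk := Real.exp_pos (s * (x (k + 1) - x k) - s ^ 2 / 2 * h)
      by_cases hg : ModerateUpTo K T x k
      · by_cases hd : 1 < |x (k + 1) - x k|
        · simp only [moderateIndicator, jumpIndicator, hg, hd, if_true, and_self, norm_mul,
            Complex.ofReal_one, one_mul, sub_self, zero_mul, zero_add]
          gcongr
          exact (h₂ _ h hh hh1).trans (le_add_of_nonneg_left (by positivity))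
        · simp only [moderateIndicator, jumpIndicator, hg, hd, if_true, and_false, if_false, norm_mul,
            Complex.ofReal_one, one_mul, sub_zero, zero_mul, mul_zero, add_zero]
          gcongr
          exact h₃ _ h (not_lt.1 hd) hh hh1
      · simp only [moderateIndicator, jumpIndicator, hg, if_false, false_and,
            Complex.ofReal_zero, norm_zero, zero_mul, sub_zero, mul_zero, add_zero, zero_add]
        positivity
    have hsecond := (norm_sum_le _ _).trans (Finset.sum_le_sum hterm)
    rw [← Finset.mul_sum, Finset.sum_add_distrib, ← Finset.mul_sum, ← Finset.mul_sum,
      Finset.sum_add_distrib, Finset.sum_const, Finset.card_range, nsmul_eq_mul, hnT] at hsecond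
    have hsq := sum_moderate_sub_jump_mul_sq_le K x n hT
    set J := ∑ k ∈ Finset.range n, jumpIndicator K T x k *
            (1 + Real.exp (s * (x (k + 1) - x k) - s ^ 2 / 2 * h)) with hJ
    have hJ0 : 0 ≤ J := by
      refine Finset.sum_nonneg fun k _ => mul_nonneg ?_ (by positivity)
      unfold jumpIndicator; split_ifs <;> norm_num
    rw [hrest]
    refine (norm_add_le _ _).trans ((add_le_add hfirst hsecond).trans ?_)
    have : E * (C₃ * (∑ k ∈ Finset.range n, (moderateIndicator K T x k - jumpIndicator K T x k)
      * (x (k + 1) - x k) ^ 2 + T) + C₂ * J) ≤ E * (C₃ * (2 * T + 2) + C₂ * J) := by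
      have hsq' := add_le_add_left hsq T
      linarith [mul_le_mul_of_nonneg_left (mul_le_mul_of_nonneg_left hsq' hC₃0) hE0]
    refine (add_le_add_right this _).trans ?_
    have f1 : 0 ≤ (2 * E + E * (C₃ * (2 * T + 2)) + E * C₁ + ‖a‖) * J := by positivity
    have f2 : 0 ≤ E * C₂ + E * C₁ + ‖a‖ := by positivity
    linarith
  · intro hg
    rw [hjn hg, sub_self, zero_add] at hrest
    have hone : ∀ k ∈ Finset.range n, moderateIndicator K T x k = 1 := fun k hk => by
      simp [moderateIndicator, hg.mono (Finset.mem_range.1 hk).le]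
    have hsplit : rest = a * ∑ k ∈ Finset.range n, (moderateIndicator K T x k : ℂ) *
          (M k * (((x (k + 1) - x k) ^ 2 - h : ℝ) : ℂ))
        + ∑ k ∈ Finset.range n, (moderateIndicator K T x k : ℂ) *
          (M k * (R k - a * (((x (k + 1) - x k) ^ 2 - h : ℝ) : ℂ))) := by
      rw [hrest, Finset.mul_sum, ← Finset.sum_add_distrib]
      refine Finset.sum_congr rfl fun k _ => ?_
      ring
    have herr : ‖∑ k ∈ Finset.range n, (moderateIndicator K T x k : ℂ) *
          (M k * (R k - a * (((x (k + 1) - x k) ^ 2 - h : ℝ) : ℂ)))‖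
        ≤ E * C₁ * ∑ k ∈ Finset.range n, stepError (x (k + 1) - x k) h := by
      rw [Finset.mul_sum]
      refine norm_sum_le_of_le _ fun k hk => ?_
      rw [hone k hk, Complex.ofReal_one, one_mul, norm_mul, mul_assoc]
      gcongr
      · exact hMn k (Finset.mem_range.1 hk).le
      · exact h₁ _ h (hg.2.1 k (Finset.mem_range.1 hk)) hh hh1
    rw [hsplit]
    refine (norm_add_le _ _).trans ?_
    rw [norm_mul]
    set U := ‖∑ k ∈ Finset.range n, (moderateIndicator K T x k : ℂ) *
          (M k * (((x (k + 1) - x k) ^ 2 - h : ℝ) : ℂ))‖ with hU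
    have hU0 : 0 ≤ U := norm_nonneg _
    set S := ∑ k ∈ Finset.range n, stepError (x (k + 1) - x k) h with hS
    have hS0 : 0 ≤ S := Finset.sum_nonneg fun k _ => stepError_nonneg hh
    have f1 : 0 ≤ (2 * E + E * (C₂ + C₃ * (2 * T + 2) + C₁)) * U := by positivity
    have f2 : 0 ≤ (2 * E + E * (C₂ + C₃ * (2 * T + 2)) + ‖a‖) * S := by positivity
    linarith

/-! ### Measurability of the path functionals -/

section Measurability

variable {Ω : Type*} [MeasurableSpace Ω] {X : ℕ → Ω → ℝ} {k : ℕ}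

lemma measurableSet_moderateUpTo (K T : ℝ) (hX : ∀ j ≤ k, Measurable (X j)) :
    MeasurableSet {ω | ModerateUpTo K T (fun j => X j ω) k} := by
  simp only [ModerateUpTo, Set.ofPred_and, Set.ofPred_forall]
  refine .inter (.iInter fun j => .iInter fun hj => ?_)
    (.inter (.iInter fun j => .iInter fun hj => ?_) ?_)
  · exact measurableSet_le (hX j hj).abs measurable_const
  · exact measurableSet_le ((hX (j + 1) hj).sub (hX j hj.le)).abs measurable_const
  · refine measurableSet_le (Finset.measurable_sum _ fun j hj => ?_) measurable_const
    have hj' := Finset.mem_range.1 hj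
    exact ((hX (j + 1) hj').sub (hX j hj'.le)).pow_const 2

lemma measurable_moderateIndicator (K T : ℝ) (hX : ∀ j ≤ k, Measurable (X j)) :
    Measurable fun ω => moderateIndicator K T (fun j => X j ω) k :=
  Measurable.ite (measurableSet_moderateUpTo K T hX) measurable_const measurable_const

lemma measurableSet_jump (K T : ℝ) (hX : ∀ j ≤ k + 1, Measurable (X j)) :
    MeasurableSet {ω | ModerateUpTo K T (fun j => X j ω) k ∧ 1 < |X (k + 1) ω - X k ω|} :=
  (measurableSet_moderateUpTo K T fun j hj => hX j (hj.trans (Nat.le_succ k))).inter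
    (measurableSet_lt measurable_const ((hX (k + 1) le_rfl).sub (hX k (Nat.le_succ k))).abs)

lemma measurable_phaseFactor (l h : ℝ) (hX : ∀ j ≤ k, Measurable (X j)) :
    Measurable fun ω => phaseFactor l h (fun j => X j ω) k := by
  unfold phaseFactor
  have h1 := (hX k le_rfl).sub (hX 0 (Nat.zero_le k))
  refine Complex.measurable_exp.comp ?_
  exact ((Complex.measurable_ofReal.comp h1).const_mul _).add_const _

end Measurability

/-! ### Second moments of martingale transforms -/

section SecondMoment

variable {Ω : Type*} {m : MeasurableSpace Ω} {P : Measure Ω}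

lemma integral_mul_eq_zero_of_indep {m₁ : MeasurableSpace Ω} (hm : m₁ ≤ m) {c ξ : Ω → ℝ}
    (hc : Measurable[m₁] c) (hξ : AEStronglyMeasurable[m] ξ P) (h0 : ∫ ω, ξ ω ∂P = 0)
    (hind : Indep (MeasurableSpace.comap ξ inferInstance) m₁ P) : ∫ ω, c ω * ξ ω ∂P = 0 := by
  have hi : IndepFun c ξ P := by
    rw [IndepFun_iff_Indep]
    exact indep_of_indep_of_le_left hind.symm hc.comap_le
  rw [hi.integral_fun_mul_eq_mul_integral (hc.mono hm le_rfl).aestronglyMeasurable hξ, h0, mul_zero]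

/-- Orthogonality of martingale differences: second moment of a transform by bounded adapted
weights. -/
lemma integral_sq_sum_mul_le (ℱ : Filtration ℕ m) {c ξ : ℕ → Ω → ℝ} {C : ℝ} (n : ℕ)
    (hc : ∀ k, Measurable[ℱ k] (c k)) (hC : ∀ k < n, ∀ ω, |c k ω| ≤ C)
    (hξ : ∀ k, Measurable[ℱ (k + 1)] (ξ k)) (hξ2 : ∀ k, MemLp (ξ k) 2 P)
    (hξ0 : ∀ k, ∫ ω, ξ k ω ∂P = 0)
    (hind : ∀ k, Indep (MeasurableSpace.comap (ξ k) inferInstance) (ℱ k) P) :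
    Measurable[ℱ n] (fun ω => ∑ k ∈ Finset.range n, c k ω * ξ k ω) ∧
    MemLp (fun ω => ∑ k ∈ Finset.range n, c k ω * ξ k ω) 2 P ∧
    ∫ ω, (∑ k ∈ Finset.range n, c k ω * ξ k ω) ^ 2 ∂P
      ≤ C ^ 2 * ∑ k ∈ Finset.range n, ∫ ω, ξ k ω ^ 2 ∂P := by
  induction n with
  | zero => simp
  | succ n ih =>
    obtain ⟨ih1, ih2, ih3⟩ := ih fun k hk => hC k (hk.trans n.lt_succ_self)
    have hCn := hC n n.lt_succ_self
    simp only [Finset.sum_range_succ]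
    set S : Ω → ℝ := fun ω => ∑ k ∈ Finset.range n, c k ω * ξ k ω with hS
    have hcm : AEStronglyMeasurable (c n) P :=
      ((hc n).mono (ℱ.le n) le_rfl).aestronglyMeasurable
    have hcξ : MemLp (fun ω => c n ω * ξ n ω) 2 P := by
      refine ((hξ2 n).const_mul C).of_le (hcm.mul (hξ2 n).aestronglyMeasurable) (ae_of_all _ ?_)
      intro ω
      rw [norm_mul, norm_mul]
      gcongr
      exact (hCn ω).trans (le_abs_self C)
    refine ⟨?_, ih2.add hcξ, ?_⟩
    · exact (ih1.mono (ℱ.mono (Nat.le_succ n)) le_rfl).add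
        (((hc n).mono (ℱ.mono (Nat.le_succ n)) le_rfl).mul (hξ n))
    · have hcross : ∫ ω, (S ω * c n ω) * ξ n ω ∂P = 0 :=
        integral_mul_eq_zero_of_indep (ℱ.le n) (ih1.mul (hc n)) (hξ2 n).aestronglyMeasurable
          (hξ0 n) (hind n)
      have hi1 : Integrable (fun ω => S ω ^ 2) P := ih2.integrable_sq
      have hi2 : Integrable (fun ω => (c n ω * ξ n ω) ^ 2) P := hcξ.integrable_sq
      have hi3 : Integrable (fun ω => S ω * c n ω * ξ n ω) P := by
        have := ih2.integrable_mul hcξ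
        exact this.congr (ae_of_all _ fun ω => (mul_assoc _ _ _).symm)
      have hexp : ∀ ω, (S ω + c n ω * ξ n ω) ^ 2
          = S ω ^ 2 + 2 * (S ω * c n ω * ξ n ω) + (c n ω * ξ n ω) ^ 2 := fun ω => by ring
      change ∫ ω, (S ω + c n ω * ξ n ω) ^ 2 ∂P ≤ _
      simp_rw [hexp]
      rw [integral_add (by exact hi1.add (hi3.const_mul 2)) hi2, integral_add hi1 (hi3.const_mul 2),
        integral_const_mul, hcross, mul_zero, add_zero, mul_add]
      refine add_le_add ih3 ?_
      rw [← integral_const_mul]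
      refine integral_mono hi2 ((hξ2 n).integrable_sq.const_mul _) fun ω => ?_
      simp only [mul_pow]
      refine mul_le_mul_of_nonneg_right ?_ (sq_nonneg _)
      rw [← sq_abs]
      exact pow_le_pow_left₀ (abs_nonneg _) (hCn ω) 2

lemma integral_abs_le_sqrt_integral_sq [IsProbabilityMeasure P] {f : Ω → ℝ} (hf : MemLp f 2 P) :
    ∫ ω, |f ω| ∂P ≤ √(∫ ω, f ω ^ 2 ∂P) := by
  apply Real.le_sqrt_of_sq_le
  have h := variance_nonneg (fun ω => |f ω|) P
  rw [variance_eq_sub (by simpa using hf.norm)] at h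
  simp only [Pi.pow_apply, sq_abs] at h
  linarith

end SecondMoment

/-! ### Moments of Gaussian increments -/

section Gaussian

variable {Ω : Type*} {m : MeasurableSpace Ω} {P : Measure Ω} {D : Ω → ℝ} {h : ℝ≥0}

lemma hasLaw_gaussianReal_eq_map (hD : HasLaw D (gaussianReal 0 h) P) :
    P.map D = (gaussianReal 0 1).map (fun z => √h * z) := by
  rw [hD.map_eq, gaussianReal_map_const_mul]
  congr 1
  · simp
  · ext; simp

lemma integrable_comp_gaussian (hD : HasLaw D (gaussianReal 0 h) P) {f : ℝ → ℝ} (hf : Measurable f)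
    (hi : Integrable (fun z => f (√h * z)) (gaussianReal 0 1)) :
    Integrable (fun ω => f (D ω)) P := by
  have h1 := (integrable_map_measure (μ := P) hf.aestronglyMeasurable hD.aemeasurable).1
  rw [hasLaw_gaussianReal_eq_map hD] at h1
  exact h1 ((integrable_map_measure hf.aestronglyMeasurable (by fun_prop)).2 hi)

lemma integral_comp_gaussian (hD : HasLaw D (gaussianReal 0 h) P) {f : ℝ → ℝ} (hf : Measurable f) :
    ∫ ω, f (D ω) ∂P = ∫ z, f (√h * z) ∂(gaussianReal 0 1) := by
  rw [← integral_map hD.aemeasurable hf.aestronglyMeasurable, hasLaw_gaussianReal_eq_map hD,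
    integral_map (by fun_prop) hf.aestronglyMeasurable]

lemma integrable_abs_pow_gaussianReal (p : ℕ) :
    Integrable (fun z => |z| ^ p) (gaussianReal 0 1) := by
  have h := (memLp_id_gaussianReal (μ := 0) (v := 1) p).integrable_norm_pow'
  simpa using h

lemma memLp_sq_sub_gaussian (hD : HasLaw D (gaussianReal 0 h) P) :
    MemLp (fun ω => D ω ^ 2 - h) 2 P := by
  have : MemLp (fun z : ℝ => z ^ 2 - h) 2 (P.map D) := by
    rw [hD.map_eq]
    refine MemLp.sub ?_ (memLp_const _)
    have h4 := memLp_id_gaussianReal (μ := 0) (v := h) 4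
    rw [memLp_two_iff_integrable_sq (by fun_prop)]
    have := h4.integrable_norm_pow (by norm_num)
    simp only [id_eq, Real.norm_eq_abs] at this
    refine this.congr (ae_of_all _ fun z => ?_)
    simp only [← pow_mul]
    exact Even.pow_abs (by decide) z
  exact this.comp_of_map hD.aemeasurable

lemma integral_sq_sub_gaussian (hD : HasLaw D (gaussianReal 0 h) P) :
    ∫ ω, (D ω ^ 2 - h) ∂P = 0 := by
  have hv := variance_fun_id_gaussianReal (μ := 0) (v := h)
  have hm : MemLp (fun z : ℝ => z) 2 (gaussianReal 0 h) := memLp_id_gaussianReal 2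
  rw [variance_eq_sub hm, integral_id_gaussianReal] at hv
  rw [← integral_map (f := fun z => z ^ 2 - (h : ℝ)) hD.aemeasurable (by fun_prop), hD.map_eq,
    integral_sub hm.integrable_sq (integrable_const _)]
  simp only [Pi.pow_apply] at hv
  simp
  linarith

lemma integral_sq_sub_sq_gaussian (hD : HasLaw D (gaussianReal 0 h) P) :
    ∫ ω, (D ω ^ 2 - h) ^ 2 ∂P = h ^ 2 * ∫ z, (z ^ 2 - 1) ^ 2 ∂(gaussianReal 0 1) := by
  rw [integral_comp_gaussian hD (f := fun z => (z ^ 2 - (h : ℝ)) ^ 2) (by fun_prop),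
    ← integral_const_mul]
  congr 1 with z
  rw [mul_pow, Real.sq_sqrt h.coe_nonneg]
  ring

lemma integrable_stepError_gaussian (hD : HasLaw D (gaussianReal 0 h) P) :
    Integrable (fun ω => stepError (D ω) h) P := by
  unfold stepError
  have e1 := integrable_comp_gaussian hD (f := fun z => |z| ^ 3) (by fun_prop)
    (by simpa [abs_mul, mul_pow] using (integrable_abs_pow_gaussianReal 3).const_mul _)
  have e2 := integrable_comp_gaussian hD (f := fun z => |z|) (by fun_prop)
    (by simpa [abs_mul] using (integrable_abs_pow_gaussianReal 1).const_mul |√h|)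
  have : IsProbabilityMeasure P := hD.isProbabilityMeasure
  exact (e1.add (e2.const_mul _)).add (integrable_const _)

/-- Writing D = √h Z, both |D|³ and h|D| scale like h√h, and h² ≤ h√h for h ≤ 1. Summed over T/h
steps, the errors are O(√h). -/
lemma exists_integral_stepError_le : ∃ C : ℝ, 0 ≤ C ∧ ∀ {Ω : Type*} {_ : MeasurableSpace Ω}
    {P : Measure Ω} {D : Ω → ℝ} {h : ℝ≥0}, h ≤ 1 → HasLaw D (gaussianReal 0 h) P →
    ∫ ω, stepError (D ω) h ∂P ≤ C * (h * √h) := by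
  set m₃ := ∫ z, |z| ^ 3 ∂(gaussianReal 0 1) with hm₃
  set m₁ := ∫ z, |z| ^ 1 ∂(gaussianReal 0 1) with hm₁
  have hm₃0 : 0 ≤ m₃ := integral_nonneg fun z => by positivity
  have hm₁0 : 0 ≤ m₁ := integral_nonneg fun z => by positivity
  refine ⟨m₃ + m₁ + 1, by positivity, fun {Ω _ P D h} hh hD => ?_⟩
  rw [integral_comp_gaussian hD (f := fun z => stepError z h) (by unfold stepError; fun_prop)]
  have hs : ∀ z : ℝ, stepError (√h * z) h
      = (h * √h) * |z| ^ 3 + (h * √h) * |z| ^ 1 + (h : ℝ) ^ 2 := by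
    intro z
    have : √(h : ℝ) ^ 3 = h * √h := by rw [pow_succ, Real.sq_sqrt h.coe_nonneg]
    simp only [stepError, abs_mul, mul_pow, abs_of_nonneg (Real.sqrt_nonneg (h : ℝ)), this]
    ring
  simp_rw [hs]
  have i₃ := (integrable_abs_pow_gaussianReal 3).const_mul (h * √h)
  have i₁ := (integrable_abs_pow_gaussianReal 1).const_mul (h * √h)
  rw [integral_add (by exact i₃.add i₁) (integrable_const _), integral_add i₃ i₁, integral_const_mul, integral_const_mul,
    ← hm₃, ← hm₁]
  have h1 : (h : ℝ) ^ 2 ≤ h * √h := by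
    rw [sq]
    gcongr
    apply Real.le_sqrt_of_sq_le
    exact pow_le_of_le_one h.coe_nonneg (by exact_mod_cast hh) (by norm_num)
  simp
  linarith

end Gaussian

/-! ### Quadratic variation along grids under P -/

/-- The process `W` has the increments of a Brownian motion with respect to the filtration `𝓖`. -/
structure HasBrownianIncrements {Ω : Type*} {m : MeasurableSpace Ω} (W : ℝ≥0 → Ω → ℝ)
    (𝓖 : Filtration ℝ≥0 m) (P : Measure Ω) : Prop where
  measurable : ∀ t, Measurable[𝓖 t] (W t)
  law : ∀ s h, HasLaw (fun ω => W (s + h) ω - W s ω) (gaussianReal 0 h) P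
  indep : ∀ s h, Indep (MeasurableSpace.comap (fun ω => W (s + h) ω - W s ω) inferInstance) (𝓖 s) P

/-- The restriction of a filtration to the time grid `s + k h`. -/
def gridFiltration {Ω : Type*} {m : MeasurableSpace Ω} (𝓖 : Filtration ℝ≥0 m) (s h : ℝ≥0) :
    Filtration ℕ m where
  seq k := 𝓖 (s + k * h)
  mono' i j hij := 𝓖.mono (by gcongr)
  le' k := 𝓖.le _

/-- The path of `B` along the time grid `s + k h`. -/
def gridPath {Ω : Type*} (B : ℝ≥0 → Ω → ℝ) (s h : ℝ≥0) (ω : Ω) (k : ℕ) : ℝ := B (s + k * h) ω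

/-- The terms which have to vanish in the limit of fine grids for `B` to have the quadratic
variation of a Brownian motion. -/
noncomputable def gridError (l K T h : ℝ) (n : ℕ) (x : ℕ → ℝ) : ℝ :=
  ‖∑ k ∈ Finset.range n, (moderateIndicator K T x k : ℂ) *
      (phaseFactor l h x k * (((x (k + 1) - x k) ^ 2 - h : ℝ) : ℂ))‖
    + |∑ k ∈ Finset.range n, ((x (k + 1) - x k) ^ 2 - h)|
    + ∑ k ∈ Finset.range n, stepError (x (k + 1) - x k) h

lemma gridError_nonneg (l K T : ℝ) {h : ℝ} (hh : 0 ≤ h) (n : ℕ) (x : ℕ → ℝ) :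
    0 ≤ gridError l K T h n x :=
  add_nonneg (by positivity) (Finset.sum_nonneg fun _ _ => stepError_nonneg hh)

/-- A drift θh is negligible against increments of order √h: it changes `stepError`, and in
`abs_drift_terms_le` also d² - h, only by multiples of `stepError`. -/
lemma stepError_add_drift_le (θ : ℝ) {d h : ℝ} (hh : 0 ≤ h) (hh1 : h ≤ 1) :
    stepError (d + θ * h) h ≤ (5 + 4 * |θ| ^ 3 + |θ|) * stepError d h := by
  unfold stepError
  have h1 : |d + θ * h| ≤ |d| + |θ| * h :=
    (abs_add_le _ _).trans (by rw [abs_mul, abs_of_nonneg hh])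
  have hd : 0 ≤ |d| := abs_nonneg _
  have hθ : 0 ≤ |θ| := abs_nonneg _
  have h2 : |d + θ * h| ^ 3 ≤ 4 * (|d| ^ 3 + (|θ| * h) ^ 3) := by
    refine (pow_le_pow_left₀ (abs_nonneg _) h1 3).trans ?_
    have hb : 0 ≤ |θ| * h := by positivity
    nlinarith [mul_nonneg (add_nonneg hd hb) (sq_nonneg (|d| - |θ| * h))]
  have h3 : (|θ| * h) ^ 3 ≤ |θ| ^ 3 * h ^ 2 := by
    rw [mul_pow]
    gcongr 1
    exact pow_le_pow_of_le_one hh hh1 (by norm_num)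
  have h4 := mul_le_mul_of_nonneg_left h1 hh
  have f1 : 0 ≤ |θ| ^ 3 * |d| ^ 3 := by positivity
  have f2 : 0 ≤ |θ| * |d| ^ 3 := by positivity
  have f3 : 0 ≤ |θ| ^ 3 * (h * |d|) := by positivity
  have f4 : 0 ≤ |θ| * (h * |d|) := by positivity
  have f5 : 0 ≤ h * |d| := by positivity
  have f6 : 0 ≤ |d| ^ 3 := by positivity
  have f7 : 0 ≤ h ^ 2 := by positivity
  linarith

lemma abs_drift_terms_le (θ : ℝ) {d h : ℝ} (hh : 0 ≤ h) :
    |(d + θ * h) ^ 2 - h - (d ^ 2 - h)| ≤ (2 * |θ| + θ ^ 2) * stepError d h := by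
  have h1 : (d + θ * h) ^ 2 - h - (d ^ 2 - h) = 2 * θ * (h * d) + θ ^ 2 * h ^ 2 := by ring
  rw [h1]
  refine (abs_add_le _ _).trans ?_
  have h2 : |2 * θ * (h * d)| = 2 * |θ| * (h * |d|) := by
    simp only [abs_mul, abs_of_nonneg hh, abs_two]
  rw [h2, abs_of_nonneg (by positivity : 0 ≤ θ ^ 2 * h ^ 2)]
  unfold stepError
  have f1 : 0 ≤ |θ| * |d| ^ 3 := by positivity
  have f2 : 0 ≤ |θ| * h ^ 2 := by positivity
  have f3 : 0 ≤ θ ^ 2 * |d| ^ 3 := by positivity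
  have f4 : 0 ≤ θ ^ 2 * (h * |d|) := by positivity
  linarith

/-- Deterministic comparison between the grid error of a path with drift and the increments of the
path without drift. -/
lemma gridError_add_drift_le (l K T θ : ℝ) {h : ℝ} (hh : 0 ≤ h) (hh1 : h ≤ 1) {n : ℕ}
    (hnT : n * h = T) (x w : ℕ → ℝ) (hx : ∀ k, x (k + 1) - x k = w (k + 1) - w k + θ * h) :
    gridError l K T h n x ≤
      |∑ k ∈ Finset.range n, ((moderateIndicator K T x k : ℂ) * phaseFactor l h x k).re *
          ((w (k + 1) - w k) ^ 2 - h)|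
      + |∑ k ∈ Finset.range n, ((moderateIndicator K T x k : ℂ) * phaseFactor l h x k).im *
          ((w (k + 1) - w k) ^ 2 - h)|
      + |∑ k ∈ Finset.range n, 1 * ((w (k + 1) - w k) ^ 2 - h)|
      + ((Real.exp (l ^ 2 / 2 * T) + 1) * (2 * |θ| + θ ^ 2) + (5 + 4 * |θ| ^ 3 + |θ|))
        * ∑ k ∈ Finset.range n, stepError (w (k + 1) - w k) h := by
  set E := Real.exp (l ^ 2 / 2 * T)
  set D := 2 * |θ| + θ ^ 2
  set c : ℕ → ℂ := fun k => (moderateIndicator K T x k : ℂ) * phaseFactor l h x k with hc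
  have hcE : ∀ k ∈ Finset.range n, ‖c k‖ ≤ E := fun k hk => by
    rw [hc, norm_mul]
    refine (mul_le_of_le_one_left (norm_nonneg _) ?_).trans
      (norm_phaseFactor_le l hh hnT (Finset.mem_range.1 hk).le x)
    unfold moderateIndicator; split_ifs <;> simp
  set ξ : ℕ → ℝ := fun k => (w (k + 1) - w k) ^ 2 - h with hξ
  set r : ℕ → ℝ := fun k => (x (k + 1) - x k) ^ 2 - h - ξ k with hr
  have hrb : ∀ k, |r k| ≤ D * stepError (w (k + 1) - w k) h := fun k => by
    have := abs_drift_terms_le θ (d := w (k + 1) - w k) hh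
    rwa [← hx k] at this
  have hxξ : ∀ k, (x (k + 1) - x k) ^ 2 - h = ξ k + r k := fun k => by rw [hr]; ring
  have a1 : ‖∑ k ∈ Finset.range n, (moderateIndicator K T x k : ℂ) *
      (phaseFactor l h x k * (((x (k + 1) - x k) ^ 2 - h : ℝ) : ℂ))‖
      ≤ |∑ k ∈ Finset.range n, (c k).re * ξ k| + |∑ k ∈ Finset.range n, (c k).im * ξ k|
        + E * D * ∑ k ∈ Finset.range n, stepError (w (k + 1) - w k) h := by
    have e1 : ∑ k ∈ Finset.range n, (moderateIndicator K T x k : ℂ) *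
        (phaseFactor l h x k * (((x (k + 1) - x k) ^ 2 - h : ℝ) : ℂ))
        = ∑ k ∈ Finset.range n, c k * (ξ k : ℂ) + ∑ k ∈ Finset.range n, c k * (r k : ℂ) := by
      rw [← Finset.sum_add_distrib]
      refine Finset.sum_congr rfl fun k _ => ?_
      rw [hxξ k]; push_cast; ring
    -- Real and imaginary parts are separated because the second moment bound is for real weights.
    have e2 := Complex.norm_le_abs_re_add_abs_im (∑ k ∈ Finset.range n, c k * (ξ k : ℂ))
    simp only [Complex.re_sum, Complex.im_sum, Complex.re_mul_ofReal, Complex.im_mul_ofReal] at e2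
    have e3 : ‖∑ k ∈ Finset.range n, c k * (r k : ℂ)‖
        ≤ E * D * ∑ k ∈ Finset.range n, stepError (w (k + 1) - w k) h := by
      rw [Finset.mul_sum]
      refine norm_sum_le_of_le _ fun k hk => ?_
      rw [norm_mul, Complex.norm_real, Real.norm_eq_abs, mul_assoc]
      exact mul_le_mul (hcE k hk) (hrb k) (abs_nonneg _) (Real.exp_pos _).le
    rw [e1]
    exact (norm_add_le _ _).trans (add_le_add e2 e3)
  have a2 : |∑ k ∈ Finset.range n, ((x (k + 1) - x k) ^ 2 - h)|
      ≤ |∑ k ∈ Finset.range n, 1 * ξ k|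
        + D * ∑ k ∈ Finset.range n, stepError (w (k + 1) - w k) h := by
    simp_rw [hxξ, Finset.sum_add_distrib, one_mul]
    refine (abs_add_le _ _).trans (add_le_add_right ?_ _)
    rw [Finset.mul_sum]
    exact (Finset.abs_sum_le_sum_abs _ _).trans (Finset.sum_le_sum fun k _ => hrb k)
  have a3 : ∑ k ∈ Finset.range n, stepError (x (k + 1) - x k) h
      ≤ (5 + 4 * |θ| ^ 3 + |θ|) * ∑ k ∈ Finset.range n, stepError (w (k + 1) - w k) h := by
    rw [Finset.mul_sum]
    refine Finset.sum_le_sum fun k _ => ?_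
    rw [hx k]
    exact stepError_add_drift_le θ hh hh1
  unfold gridError
  linarith

lemma measurable_gridError {Ω : Type*} [MeasurableSpace Ω] (l K T h : ℝ) (n : ℕ) {x : Ω → ℕ → ℝ}
    (hx : ∀ j ≤ n, Measurable fun ω => x ω j) :
    Measurable fun ω => gridError l K T h n (x ω) := by
  have hd : ∀ k ∈ Finset.range n, Measurable fun ω => x ω (k + 1) - x ω k := fun k hk =>
    (hx _ (Finset.mem_range.1 hk)).sub (hx _ (Finset.mem_range.1 hk).le)
  have hq : ∀ k ∈ Finset.range n, Measurable fun ω => (x ω (k + 1) - x ω k) ^ 2 - h := fun k hk =>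
    ((hd k hk).pow_const 2).sub_const h
  refine (Measurable.add ?_ (Finset.measurable_sum _ hq).abs).add
    (Finset.measurable_sum _ fun k hk => ?_)
  · refine (Finset.measurable_sum _ fun k hk => ?_).norm
    have hk' : ∀ j ≤ k, Measurable fun ω => x ω j := fun j hj =>
      hx j (hj.trans (Finset.mem_range.1 hk).le)
    exact (Complex.measurable_ofReal.comp
      (measurable_moderateIndicator (X := fun j ω => x ω j) K T hk')).mul
      ((measurable_phaseFactor (X := fun j ω => x ω j) l h hk').mul
        (Complex.measurable_ofReal.comp (hq k hk)))
  · unfold stepError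
    exact (((hd k hk).abs.pow_const 3).add ((hd k hk).abs.const_mul h)).add_const _

section Grid

variable {Ω : Type*} {m : MeasurableSpace Ω} {P : Measure Ω}
  {W : ℝ≥0 → Ω → ℝ} {𝓖 : Filtration ℝ≥0 m}

lemma measurable_gridPath {B : ℝ≥0 → Ω → ℝ} (hB : ∀ t, Measurable[𝓖 t] (B t)) (s h : ℝ≥0) {k j : ℕ}
    (hj : j ≤ k) : Measurable[gridFiltration 𝓖 s h k] (fun ω => gridPath B s h ω j) :=
  (hB (s + j * h)).mono (𝓖.mono (by gcongr)) le_rfl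

/-- The grid error of a Brownian motion with drift tends to zero in mean. -/
theorem exists_integral_gridError_le [IsProbabilityMeasure P] (hW : HasBrownianIncrements W 𝓖 P)
    {B : ℝ≥0 → Ω → ℝ} {θ : ℝ} (hB : ∀ t ω, B t ω = W t ω + θ * t) (l : ℝ) {T : ℝ} (hT : 0 ≤ T) :
    ∃ D : ℝ, ∀ (K : ℝ) (s h : ℝ≥0) (n : ℕ), h ≤ 1 → n * (h : ℝ) = T →
      Integrable (fun ω => gridError l K T h n (gridPath B s h ω)) P ∧
      ∫ ω, gridError l K T h n (gridPath B s h ω) ∂P ≤ D * √h := by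
  obtain ⟨C, hC, hCb⟩ := exists_integral_stepError_le
  set E := Real.exp (l ^ 2 / 2 * T) with hE
  set G := (E + 1) * (2 * |θ| + θ ^ 2) + (5 + 4 * |θ| ^ 3 + |θ|) with hG
  have hG0 : 0 ≤ G := by positivity
  set c₄ := ∫ z, (z ^ 2 - 1) ^ 2 ∂(gaussianReal 0 1) with hc₄
  have hc₄0 : 0 ≤ c₄ := integral_nonneg fun z => sq_nonneg _
  -- Three transforms of d² - h, with weights bounded by E, E and 1, have L¹ norm at most √(T c₄ h)
  -- times the bound; the last term collects the drift and remainder errors.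
  refine ⟨(2 * E + 1) * √(T * c₄) + G * (C * T), fun K s h n hh hnT => ?_⟩
  have hBm : ∀ t, Measurable[𝓖 t] (B t) := fun t => by
    have : B t = fun ω => W t ω + θ * t := funext (hB t)
    rw [this]; exact (hW.measurable t).add_const _
  set ℱ := gridFiltration 𝓖 s h with hℱ
  have hsucc : ∀ k : ℕ, s + ((k + 1 : ℕ) : ℝ≥0) * h = s + k * h + h := fun k => by
    push_cast; ring
  set ξ : ℕ → Ω → ℝ := fun k ω => (gridPath W s h ω (k + 1) - gridPath W s h ω k) ^ 2 - h with hξ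
  have hlaw : ∀ k, HasLaw (fun ω => gridPath W s h ω (k + 1) - gridPath W s h ω k)
      (gaussianReal 0 h) P := fun k => by
    simp only [gridPath, hsucc]; exact hW.law _ _
  have hξm : ∀ k, Measurable[ℱ (k + 1)] (ξ k) := fun k =>
    ((((measurable_gridPath hW.measurable s h le_rfl).sub
      (measurable_gridPath hW.measurable s h (Nat.le_succ k))).pow_const 2).sub_const _)
  have hξ2 : ∀ k, MemLp (ξ k) 2 P := fun k => memLp_sq_sub_gaussian (hlaw k)
  have hξ0 : ∀ k, ∫ ω, ξ k ω ∂P = 0 := fun k => integral_sq_sub_gaussian (hlaw k)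
  have hξi : ∀ k, Indep (MeasurableSpace.comap (ξ k) inferInstance) (ℱ k) P := fun k => by
    have := hW.indep (s + k * h) h
    refine indep_of_indep_of_le_left this ?_
    rw [← hsucc]
    have hcomp : ξ k = (fun z => z ^ 2 - (h : ℝ)) ∘
        (fun ω => W (s + ((k + 1 : ℕ) : ℝ≥0) * h) ω - W (s + k * h) ω) := rfl
    rw [hcomp, ← MeasurableSpace.comap_comp]
    exact MeasurableSpace.comap_mono (by
      have : Measurable fun z : ℝ => z ^ 2 - (h : ℝ) := by fun_prop
      exact this.comap_le)
  -- There are T/h steps of variance c₄h² each, so the total variance vanishes with h.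
  have hξs : ∑ k ∈ Finset.range n, ∫ ω, ξ k ω ^ 2 ∂P = T * c₄ * h := by
    have : ∀ k, ∫ ω, ξ k ω ^ 2 ∂P = h ^ 2 * c₄ := fun k => integral_sq_sub_sq_gaussian (hlaw k)
    simp_rw [this, Finset.sum_const, Finset.card_range, nsmul_eq_mul]
    rw [← hnT]; ring
  have key : ∀ (c : ℕ → Ω → ℝ) (A : ℝ), 0 ≤ A → (∀ k, Measurable[ℱ k] (c k)) →
      (∀ k < n, ∀ ω, |c k ω| ≤ A) →
      Integrable (fun ω => |∑ k ∈ Finset.range n, c k ω * ξ k ω|) P ∧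
      ∫ ω, |∑ k ∈ Finset.range n, c k ω * ξ k ω| ∂P ≤ A * (√(T * c₄) * √h) := by
    intro c A hA hcm hcA
    obtain ⟨-, k2, k3⟩ := integral_sq_sum_mul_le ℱ n hcm hcA hξm hξ2 hξ0 hξi
    rw [hξs] at k3
    refine ⟨(k2.integrable one_le_two).abs, (integral_abs_le_sqrt_integral_sq k2).trans ?_⟩
    refine (Real.sqrt_le_sqrt k3).trans (le_of_eq ?_)
    rw [Real.sqrt_mul (sq_nonneg A), Real.sqrt_sq hA, Real.sqrt_mul (by positivity)]
  set c : ℕ → Ω → ℂ := fun k ω => (moderateIndicator K T (gridPath B s h ω) k : ℂ) *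
    phaseFactor l h (gridPath B s h ω) k with hc
  have hcm : ∀ k, Measurable[ℱ k] (c k) := fun k =>
    Measurable.mul (Complex.measurable_ofReal.comp
      (@measurable_moderateIndicator Ω (ℱ k) (fun j ω => gridPath B s h ω j) k K T
        fun j hj => measurable_gridPath hBm s h hj))
      (@measurable_phaseFactor Ω (ℱ k) (fun j ω => gridPath B s h ω j) k l h
        fun j hj => measurable_gridPath hBm s h hj)
  have hcE : ∀ k < n, ∀ ω, ‖c k ω‖ ≤ E := fun k hk ω => by
    rw [hc, norm_mul]
    refine (mul_le_of_le_one_left (norm_nonneg _) ?_).trans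
      (norm_phaseFactor_le l h.coe_nonneg hnT hk.le _)
    unfold moderateIndicator; split_ifs <;> simp
  obtain ⟨i1, b1⟩ := key (fun k ω => (c k ω).re) E (Real.exp_pos _).le
    (fun k => Complex.measurable_re.comp (hcm k))
    (fun k hk ω => (Complex.abs_re_le_norm _).trans (hcE k hk ω))
  obtain ⟨i2, b2⟩ := key (fun k ω => (c k ω).im) E (Real.exp_pos _).le
    (fun k => Complex.measurable_im.comp (hcm k))
    (fun k hk ω => (Complex.abs_im_le_norm _).trans (hcE k hk ω))
  obtain ⟨i3, b3⟩ := key (fun _ _ => 1) 1 zero_le_one (fun k => measurable_const) (by simp)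
  have i4 : Integrable (fun ω => ∑ k ∈ Finset.range n,
      stepError (gridPath W s h ω (k + 1) - gridPath W s h ω k) h) P :=
    integrable_finsetSum _ fun k _ => integrable_stepError_gaussian (hlaw k)
  have b4 : ∫ ω, ∑ k ∈ Finset.range n,
      stepError (gridPath W s h ω (k + 1) - gridPath W s h ω k) h ∂P ≤ C * T * √h := by
    rw [integral_finsetSum _ fun k _ => integrable_stepError_gaussian (hlaw k)]
    refine (Finset.sum_le_sum fun k _ => hCb hh (hlaw k)).trans (le_of_eq ?_)
    rw [Finset.sum_const, Finset.card_range, nsmul_eq_mul, ← hnT]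
    ring
  have hpt : ∀ ω, gridError l K T h n (gridPath B s h ω) ≤ _ := fun ω =>
    gridError_add_drift_le l K T θ h.coe_nonneg (by exact_mod_cast hh) hnT (gridPath B s h ω)
      (gridPath W s h ω) (fun k => by
        simp only [gridPath, hB, hsucc]; push_cast; ring)
  have ibound := ((i1.add i2).add i3).add (i4.const_mul G)
  have hint : Integrable (fun ω => gridError l K T h n (gridPath B s h ω)) P := by
    refine ibound.mono' ?_ (ae_of_all _ fun ω => ?_)
    · refine Measurable.aestronglyMeasurable ?_
      exact measurable_gridError l K T h n fun j hj =>
        (measurable_gridPath hBm s h hj).mono (ℱ.le n) le_rfl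
    · rw [Real.norm_eq_abs, abs_of_nonneg (gridError_nonneg l K T h.coe_nonneg n _)]
      exact hpt ω
  refine ⟨hint, (integral_mono hint ibound hpt).trans ?_⟩
  simp only [Pi.add_apply]
  rw [integral_add (by exact (i1.add i2).add i3) (i4.const_mul G),
    integral_add (by exact i1.add i2) i3, integral_add i1 i2, integral_const_mul]
  have b4' := mul_le_mul_of_nonneg_left b4 hG0
  linarith

end Grid

/-! ### Passing from P to Q, martingale weights, bounds on paths -/

section Transfer

variable {Ω : Type*} {m₀ m : MeasurableSpace Ω} {P Q : Measure Ω}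

/-- Events of vanishing probability keep vanishing probability under a measure which is absolutely
continuous on the σ-algebra they belong to. -/
lemma tendsto_measure_zero_of_trim_absolutelyContinuous [IsFiniteMeasure P] [IsFiniteMeasure Q]
    (hm : m₀ ≤ m) (hQP : Q.trim hm ≪ P.trim hm) {E : ℕ → Set Ω}
    (hE : ∀ n, MeasurableSet[m₀] (E n)) (hP : Tendsto (fun n => P (E n)) atTop (𝓝 0)) :
    Tendsto (fun n => Q (E n)) atTop (𝓝 0) := by
  -- Q(E n) is the integral of one fixed integrable density over sets of vanishing P-measure.
  have h1 : ∀ n, Q (E n) = ∫⁻ ω in E n, (Q.trim hm).rnDeriv (P.trim hm) ω ∂(P.trim hm) := fun n => by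
    rw [← withDensity_apply _ (hE n), Measure.withDensity_rnDeriv_eq _ _ hQP,
      trim_measurableSet_eq hm (hE n)]
  simp_rw [h1]
  refine tendsto_setLIntegral_zero (Measure.lintegral_rnDeriv_lt_top _ _).ne ?_
  refine hP.congr fun n => ?_
  rw [Function.comp_apply, trim_measurableSet_eq hm (hE n)]

lemma tendsto_measureReal_le_zero [IsFiniteMeasure P] {f : ℕ → Ω → ℝ} (hf0 : ∀ n ω, 0 ≤ f n ω)
    (hf : ∀ᶠ n in atTop, Integrable (f n) P)
    (hlim : Tendsto (fun n => ∫ ω, f n ω ∂P) atTop (𝓝 0))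
    {ε : ℝ} (hε : 0 < ε) : Tendsto (fun n => P {ω | ε ≤ f n ω}) atTop (𝓝 0) := by
  have h1 : Tendsto (fun n => P.real {ω | ε ≤ f n ω}) atTop (𝓝 0) := by
    refine squeeze_zero' (.of_forall fun n => measureReal_nonneg) ?_
      (by simpa using hlim.div_const ε)
    filter_upwards [hf] with n hn
    rw [le_div_iff₀ hε, mul_comm]
    exact mul_meas_ge_le_integral_of_nonneg (ae_of_all _ (hf0 n)) hn ε
  have := (ENNReal.continuous_ofReal.tendsto 0).comp h1
  simpa [Function.comp_def] using this

end Transfer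

section Martingale

variable {Ω : Type*} {m : MeasurableSpace Ω} {Q : Measure Ω} [IsProbabilityMeasure Q]
  {𝓖 : Filtration ℝ≥0 m} {N : ℝ≥0 → Ω → ℝ}

/-- The pull-out property of conditional expectation, in bilinear form because the weights will be
complex valued. -/
lemma MeasureTheory.Martingale.integral_smul_eq (hN : Martingale N 𝓖 Q) {s t : ℝ≥0} (hst : s ≤ t)
    {E : Type*} [NormedAddCommGroup E] [NormedSpace ℝ E] [CompleteSpace E]
    {c : Ω → E} (hc : StronglyMeasurable[𝓖 s] c) {C : ℝ} (hC : ∀ ω, ‖c ω‖ ≤ C) :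
    Integrable (fun ω => N t ω • c ω) Q ∧ ∫ ω, N t ω • c ω ∂Q = ∫ ω, N s ω • c ω ∂Q := by
  have hcm : AEStronglyMeasurable c Q := (hc.mono (𝓖.le s)).aestronglyMeasurable
  have hi : ∀ t, Integrable (fun ω => N t ω • c ω) Q := fun t =>
    (hN.integrable t).smul_bdd C hcm (ae_of_all _ hC)
  refine ⟨hi t, ?_⟩
  have hpull := condExp_bilin_of_aestronglyMeasurable_left (μ := Q)
    (ContinuousLinearMap.lsmul ℝ ℝ (E := E)).flip (m := 𝓖 s) (f := c) (g := N t)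
    hc.aestronglyMeasurable (hi t) (hN.integrable t)
  rw [← integral_condExp (𝓖.le s)]
  refine integral_congr_ae ?_
  filter_upwards [hpull, hN.condExp_ae_eq hst] with ω h1 h2
  simpa [h2] using h1

end Martingale

section Running

variable {Ω : Type*} {m : MeasurableSpace Ω} {Q : Measure Ω} [IsFiniteMeasure Q]

/-- A process with continuous paths is bounded on compact time intervals, up to events of small
probability. -/
lemma exists_tendsto_measure_unbounded {B : ℝ≥0 → Ω → ℝ} (hB : ∀ t, Measurable (B t))
    (hc : ∀ ω, Continuous fun t => B t ω) (T : ℝ≥0) :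
    ∃ H : ℕ → Set Ω, (∀ K, MeasurableSet (H K)) ∧
      (∀ K ω, ω ∉ H K → ∀ t ≤ T, |B t ω| ≤ K) ∧ Tendsto (fun K => Q.real (H K)) atTop (𝓝 0) := by
  obtain ⟨D, hDc, hDd⟩ := TopologicalSpace.exists_countable_dense ℝ≥0
  -- A countable dense set of times keeps H measurable. The range is enlarged to T + 1 so that an
  -- excess at any t ≤ T, even t = T, persists on an open set of times within the range.
  set H : ℕ → Set Ω := fun K => ⋃ q ∈ D, ⋃ (_ : q < T + 1), {ω | (K : ℝ) < |B q ω|} with hH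
  have hHm : ∀ K, MeasurableSet (H K) := fun K =>
    .biUnion hDc fun q _ => .iUnion fun _ => measurableSet_lt measurable_const (hB q).abs
  refine ⟨H, hHm, fun K ω hω t ht => ?_, ?_⟩
  · by_contra! hlt
    have ho : IsOpen {q : ℝ≥0 | (K : ℝ) < |B q ω| ∧ q < T + 1} :=
      (isOpen_lt continuous_const (hc ω).abs).inter isOpen_Iio
    obtain ⟨q, ⟨hq1, hq2⟩, hqD⟩ := hDd.inter_open_nonempty _ ho
      ⟨t, hlt, ht.trans_lt (lt_add_one T)⟩
    exact hω (Set.mem_biUnion hqD (Set.mem_iUnion.2 ⟨hq2, hq1⟩))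
  · have hanti : Antitone H := fun K K' hK ω hω => by
      simp only [hH, Set.mem_iUnion, Set.mem_ofPred_eq] at hω ⊢
      obtain ⟨q, h1, h2, h3⟩ := hω
      exact ⟨q, h1, h2, lt_of_le_of_lt (by exact_mod_cast hK) h3⟩
    have hempty : ⋂ K, H K = ∅ := by
      rw [Set.eq_empty_iff_forall_notMem]
      intro ω hω
      obtain ⟨R, hR⟩ := (isCompact_Icc (a := (0 : ℝ≥0)) (b := T + 1)).exists_bound_of_continuousOn
        (hc ω).continuousOn
      obtain ⟨K, hK⟩ := exists_nat_ge R
      have := Set.mem_iInter.1 hω K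
      simp only [hH, Set.mem_iUnion, Set.mem_ofPred_eq] at this
      obtain ⟨q, -, h2, h3⟩ := this
      have := hR q ⟨zero_le, h2.le⟩
      rw [Real.norm_eq_abs] at this
      linarith
    have := tendsto_measure_iInter_atTop (μ := Q) (fun K => (hHm K).nullMeasurableSet) hanti
      ⟨0, measure_ne_top _ _⟩
    rw [hempty, measure_empty] at this
    exact (ENNReal.tendsto_toReal ENNReal.zero_ne_top).comp this

end Running

/-! ### Large steps and the grid error -/

lemma jumpIndicator_nonneg (K T : ℝ) (x : ℕ → ℝ) (k : ℕ) : 0 ≤ jumpIndicator K T x k := by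
  unfold jumpIndicator; split_ifs <;> norm_num

/-- A large step ends moderateness for good, so it is counted once: each indicator is at most the
drop of `moderateIndicator`, and the drops telescope. -/
lemma sum_jumpIndicator_le (K T : ℝ) (x : ℕ → ℝ) (n : ℕ) :
    ∑ k ∈ Finset.range n, jumpIndicator K T x k ≤ 1 := by
  have h : ∀ k, jumpIndicator K T x k ≤ moderateIndicator K T x k - moderateIndicator K T x (k + 1) := by
    intro k
    unfold jumpIndicator moderateIndicator
    by_cases h1 : ModerateUpTo K T x (k + 1)
    · have h2 := h1.mono (Nat.le_succ k)
      have h3 := not_lt.2 (h1.2.1 k (Nat.lt_succ_self k))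
      simp [h1, h2, h3]
    · by_cases h2 : ModerateUpTo K T x k
      · simp only [h1, h2, if_true, if_false, true_and]; split_ifs <;> norm_num
      · simp [h1, h2]
  refine (Finset.sum_le_sum fun k _ => h k).trans ?_
  rw [Finset.sum_range_sub']
  have h0 : moderateIndicator K T x 0 ≤ 1 := by unfold moderateIndicator; split_ifs <;> norm_num
  have hn : 0 ≤ moderateIndicator K T x n := by unfold moderateIndicator; split_ifs <;> norm_num
  linarith

lemma one_le_gridError_of_jump {l K T h : ℝ} (hh : 0 ≤ h) {n k : ℕ} (hk : k < n) {x : ℕ → ℝ}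
    (hx : 1 < |x (k + 1) - x k|) : 1 < gridError l K T h n x := by
  have h1 : 1 < stepError (x (k + 1) - x k) h := by
    unfold stepError
    have : 1 < |x (k + 1) - x k| ^ 3 := one_lt_pow₀ hx (by norm_num)
    have : 0 ≤ h * |x (k + 1) - x k| := by positivity
    nlinarith [sq_nonneg h]
  refine h1.trans_le ((Finset.single_le_sum (f := fun k => stepError (x (k + 1) - x k) h)
    (fun _ _ => stepError_nonneg hh) (Finset.mem_range.2 hk)).trans ?_)
  exact le_add_of_nonneg_left (by positivity)

/-- The cubic term of `stepError` excludes large steps, and the middle term of `gridError` keeps the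
quadratic variation within 1 of nh = T. This is the origin of T + 1 in `ModerateUpTo`. -/
lemma moderateUpTo_of_gridError_le {l K T h : ℝ} (hh : 0 ≤ h) {n : ℕ} (hnT : n * h = T) {x : ℕ → ℝ}
    (hx : ∀ j ≤ n, |x j| ≤ K) (he : gridError l K T h n x ≤ 1) : ModerateUpTo K T x n := by
  refine ⟨hx, fun j hj => ?_, ?_⟩
  · by_contra! hlt
    exact absurd (one_le_gridError_of_jump hh hj hlt) (not_lt.2 he)
  · have h1 : |∑ k ∈ Finset.range n, ((x (k + 1) - x k) ^ 2 - h)| ≤ gridError l K T h n x := by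
      unfold gridError
      have : 0 ≤ ∑ k ∈ Finset.range n, stepError (x (k + 1) - x k) h :=
        Finset.sum_nonneg fun _ _ => stepError_nonneg hh
      linarith [norm_nonneg (∑ k ∈ Finset.range n, (moderateIndicator K T x k : ℂ) *
      (phaseFactor l h x k * (((x (k + 1) - x k) ^ 2 - h : ℝ) : ℂ)))]
    have h2 := (le_abs_self _).trans (h1.trans he)
    rw [Finset.sum_sub_distrib, Finset.sum_const, Finset.card_range, nsmul_eq_mul, hnT] at h2
    linarith

/-! ### Discrete stochastic integrals against the exponential martingale -/

section Levy

variable {Ω : Type*} {m : MeasurableSpace Ω} {P Q : Measure Ω} {𝓖 : Filtration ℝ≥0 m}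
  {W B : ℝ≥0 → Ω → ℝ} {θ σ : ℝ}

/-- The exponential martingale of `B` with parameter `σ`. -/
noncomputable def expProcess (σ : ℝ) (B : ℝ≥0 → Ω → ℝ) (t : ℝ≥0) (ω : Ω) : ℝ :=
  Real.exp (σ * B t ω - σ ^ 2 / 2 * t)

lemma expProcess_pos (σ : ℝ) (B : ℝ≥0 → Ω → ℝ) (t : ℝ≥0) (ω : Ω) : 0 < expProcess σ B t ω :=
  Real.exp_pos _

lemma gridPath_add_mul_succ (B : ℝ≥0 → Ω → ℝ) (s h : ℝ≥0) (ω : Ω) (k : ℕ) :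
    gridPath B s h ω (k + 1) = B (s + k * h + h) ω := by
  unfold gridPath; congr 1; push_cast; ring

lemma exp_step_eq_mul_inv (σ : ℝ) (B : ℝ≥0 → Ω → ℝ) (s h : ℝ≥0) (ω : Ω) (k : ℕ) :
    Real.exp (σ * (gridPath B s h ω (k + 1) - gridPath B s h ω k) - σ ^ 2 / 2 * h)
      = expProcess σ B (s + k * h + h) ω * (expProcess σ B (s + k * h) ω)⁻¹ := by
  rw [gridPath_add_mul_succ, expProcess, expProcess, ← Real.exp_neg, ← Real.exp_add]
  congr 1
  simp only [gridPath]
  push_cast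
  ring

/-- Keeps bounded the weights that arise when a step ratio of the exponential martingale is
rewritten as its right endpoint divided by its left endpoint. -/
lemma inv_expProcess_le_of_moderateUpTo (hσ : 0 < σ) {K T : ℝ} {s h : ℝ≥0} {ω : Ω} {n k : ℕ}
    (hk : k ≤ n) (hg : ModerateUpTo K T (gridPath B s h ω) k) :
    (expProcess σ B (s + k * h) ω)⁻¹ ≤ Real.exp (σ * K + σ ^ 2 / 2 * (s + n * h : ℝ≥0)) := by
  rw [expProcess, ← Real.exp_neg]
  have h1 := (abs_le.1 (hg.1 k le_rfl)).1
  simp only [gridPath] at h1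
  have h2 : ((s + k * h : ℝ≥0) : ℝ) ≤ ((s + n * h : ℝ≥0) : ℝ) := by
    have : (s + k * h : ℝ≥0) ≤ s + n * h := by gcongr
    exact_mod_cast this
  gcongr
  have h3 := mul_le_mul_of_nonneg_left h1 hσ.le
  have h4 := mul_le_mul_of_nonneg_left h2 (by positivity : 0 ≤ σ ^ 2 / 2)
  linarith

variable [IsProbabilityMeasure Q]

/-- The terms of the discrete stochastic integral have zero mean. -/
lemma setIntegral_integral_term_eq_zero (hσ : 0 < σ) (hBm : ∀ t, Measurable[𝓖 t] (B t))
    (hN : Martingale (expProcess σ B) 𝓖 Q) (l K : ℝ) {T : ℝ} (s h : ℝ≥0) {n : ℕ}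
    (hnT : n * (h : ℝ) = T) {A : Set Ω} (hA : MeasurableSet[𝓖 s] A) {k : ℕ} (hk : k < n) :
    let f : Ω → ℂ := fun ω => (moderateIndicator K T (gridPath B s h ω) k : ℂ) *
        (phaseFactor l h (gridPath B s h ω) k * (Complex.I * l / σ *
          ((Real.exp (σ * (gridPath B s h ω (k + 1) - gridPath B s h ω k)
            - σ ^ 2 / 2 * h) - 1 : ℝ) : ℂ)))
    IntegrableOn f A Q ∧ ∫ ω in A, f ω ∂Q = 0 := by
  intro f
  have hAm : MeasurableSet A := 𝓖.le s A hA
  -- Dividing by the martingale at the left endpoint turns the term f on A into d times a martingale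
  -- increment, with d known at that endpoint.
  set d : Ω → ℂ := fun ω => (moderateIndicator K T (gridPath B s h ω) k : ℂ) *
        (phaseFactor l h (gridPath B s h ω) k * (Complex.I * l / σ *
          (((expProcess σ B (s + k * h) ω)⁻¹ : ℝ) : ℂ))) with hd
  set c : Ω → ℂ := A.indicator d with hc
  have hNm : Measurable[𝓖 (s + k * h)] (expProcess σ B (s + k * h)) :=
    (hN.stronglyAdapted _).measurable
  have hdm : Measurable[𝓖 (s + k * h)] d := by
    refine Measurable.mul (Complex.measurable_ofReal.comp
      (@measurable_moderateIndicator Ω (gridFiltration 𝓖 s h k) (fun j ω => gridPath B s h ω j) k K T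
        fun j hj => measurable_gridPath hBm s h hj)) (Measurable.mul
      (@measurable_phaseFactor Ω (gridFiltration 𝓖 s h k) (fun j ω => gridPath B s h ω j) k l h
        fun j hj => measurable_gridPath hBm s h hj) ?_)
    exact (Complex.measurable_ofReal.comp hNm.inv).const_mul _
  have hcm : Measurable[𝓖 (s + k * h)] c := hdm.indicator (𝓖.mono le_self_add A hA)
  set C := Real.exp (l ^ 2 / 2 * T) * (‖Complex.I * l / σ‖ *
    Real.exp (σ * K + σ ^ 2 / 2 * (s + n * h : ℝ≥0))) with hC
  have hC0 : 0 ≤ C := by positivity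
  have hcC : ∀ ω, ‖c ω‖ ≤ C := fun ω => by
    refine (norm_indicator_le_norm_self _ _).trans ?_
    by_cases hg : ModerateUpTo K T (gridPath B s h ω) k
    · simp only [hd, moderateIndicator, hg, if_true, norm_mul, Complex.norm_real, norm_one,
        one_mul, hC]
      gcongr
      · exact norm_phaseFactor_le l h.coe_nonneg hnT hk.le _
      · rw [Real.norm_eq_abs, abs_of_pos (inv_pos.2 (expProcess_pos _ _ _ _))]
        exact inv_expProcess_le_of_moderateUpTo hσ hk.le hg
    · simp [hd, moderateIndicator, hg, hC0]
  obtain ⟨i1, e1⟩ := hN.integral_smul_eq (t := s + k * h + h) le_self_add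
    (Measurable.stronglyMeasurable hcm) hcC
  obtain ⟨i0, -⟩ := hN.integral_smul_eq (le_refl (s + k * h)) (Measurable.stronglyMeasurable hcm) hcC
  have hf : A.indicator f = fun ω => expProcess σ B (s + k * h + h) ω • c ω
      - expProcess σ B (s + k * h) ω • c ω := by
    ext ω
    by_cases hω : ω ∈ A
    · simp only [hc, Set.indicator_of_mem hω, f, hd, exp_step_eq_mul_inv, Complex.real_smul]
      have := (expProcess_pos σ B (s + k * h) ω).ne'
      have h' : ((expProcess σ B (s + k * h) ω : ℝ) : ℂ) ≠ 0 := by exact_mod_cast this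
      push_cast
      field_simp
    · simp [hc, Set.indicator_of_notMem hω]
  rw [← integrable_indicator_iff hAm, ← integral_indicator hAm, hf]
  exact ⟨i1.sub i0, by rw [integral_sub i1 i0, e1, sub_self]⟩

/-- The contribution of the large steps is controlled by an event of small probability. -/
lemma integral_jump_le (hσ : 0 < σ) (hBm : ∀ t, Measurable[𝓖 t] (B t))
    (hN : Martingale (expProcess σ B) 𝓖 Q) (l K T : ℝ) (s h : ℝ≥0) (n : ℕ)
    {ε : ℝ} (hε : ε ≤ 1) :
    let J : Ω → ℝ := fun ω => ∑ k ∈ Finset.range n, jumpIndicator K T (gridPath B s h ω) k *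
      (1 + Real.exp (σ * (gridPath B s h ω (k + 1) - gridPath B s h ω k) - σ ^ 2 / 2 * h))
    Integrable J Q ∧ ∫ ω, J ω ∂Q ≤ ∫ ω in {ω | ε ≤ gridError l K T h n (gridPath B s h ω)},
      (1 + Real.exp (σ * K + σ ^ 2 / 2 * (s + n * h : ℝ≥0)) * expProcess σ B (s + n * h) ω) ∂Q := by
  intro J
  set C := Real.exp (σ * K + σ ^ 2 / 2 * (s + n * h : ℝ≥0)) with hC
  set j : ℕ → Ω → ℝ := fun k ω => jumpIndicator K T (gridPath B s h ω) k with hj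
  have hsucc : ∀ k : ℕ, s + ((k + 1 : ℕ) : ℝ≥0) * h = s + k * h + h := fun k => by
    push_cast; ring
  have hjm : ∀ k : ℕ, Measurable[𝓖 (s + k * h + h)] (j k) := fun k => by
    rw [← hsucc]
    exact Measurable.ite (@measurableSet_jump Ω (gridFiltration 𝓖 s h (k + 1))
      (fun j ω => gridPath B s h ω j) k K T fun j hj => measurable_gridPath hBm s h hj)
      measurable_const measurable_const
  have hj1 : ∀ k ω, ‖j k ω‖ ≤ 1 := fun k ω => by
    simp only [hj, jumpIndicator]; split_ifs <;> simp
  have hji : ∀ k, Integrable (j k) Q := fun k =>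
    Integrable.of_bound ((hjm k).mono (𝓖.le _) le_rfl).aestronglyMeasurable 1 (ae_of_all _ (hj1 k))
  have hle : ∀ k ∈ Finset.range n, s + k * h + h ≤ s + n * h := fun k hk => by
    rw [← hsucc]
    have : ((k + 1 : ℕ) : ℝ≥0) ≤ n := by exact_mod_cast Finset.mem_range.1 hk
    gcongr
  have hmart : ∀ k ∈ Finset.range n, Integrable (fun ω => expProcess σ B (s + n * h) ω • j k ω) Q ∧
      Integrable (fun ω => expProcess σ B (s + k * h + h) ω • j k ω) Q ∧
      ∫ ω, expProcess σ B (s + n * h) ω • j k ω ∂Q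
        = ∫ ω, expProcess σ B (s + k * h + h) ω • j k ω ∂Q := fun k hk => by
    have hs := Measurable.stronglyMeasurable (hjm k)
    obtain ⟨a1, a2⟩ := hN.integral_smul_eq (hle k hk) hs (hj1 k)
    exact ⟨a1, (hN.integral_smul_eq le_rfl hs (hj1 k)).1, a2⟩
  set u : Ω → ℝ := fun ω => ∑ k ∈ Finset.range n,
    (j k ω + C * (expProcess σ B (s + k * h + h) ω • j k ω)) with hu
  have hui : Integrable u Q := integrable_finsetSum _ fun k hk =>
    (hji k).add ((hmart k hk).2.1.const_mul C)
  have hJ0 : ∀ ω, 0 ≤ J ω := fun ω => Finset.sum_nonneg fun k _ =>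
    mul_nonneg (jumpIndicator_nonneg _ _ _ _) (by positivity)
  have hJu : ∀ ω, J ω ≤ u ω := fun ω => by
    refine Finset.sum_le_sum fun k hk => ?_
    by_cases hg : ModerateUpTo K T (gridPath B s h ω) k
    · rw [exp_step_eq_mul_inv, mul_add, mul_one, smul_eq_mul]
      have h1 := inv_expProcess_le_of_moderateUpTo hσ (Finset.mem_range.1 hk).le hg
      have h2 : 0 ≤ j k ω := jumpIndicator_nonneg _ _ _ _
      have h3 := expProcess_pos σ B (s + k * h + h) ω
      change j k ω + j k ω * _ ≤ _
      have h4 := mul_le_mul_of_nonneg_left h1 (mul_nonneg h2 h3.le)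
      linarith
    · simp [hj, jumpIndicator, hg]
  have hJm : AEStronglyMeasurable J Q := by
    refine Measurable.aestronglyMeasurable (Finset.measurable_sum _ fun k _ => ?_)
    have hx : ∀ i, Measurable fun ω => gridPath B s h ω i := fun i =>
      (hBm _).mono (𝓖.le _) le_rfl
    exact ((hjm k).mono (𝓖.le _) le_rfl).mul (Measurable.const_add
      (Real.measurable_exp.comp ((((hx (k + 1)).sub (hx k)).const_mul σ).sub_const _)) 1)
  have hJi : Integrable J Q := hui.mono' hJm (ae_of_all _ fun ω => by
    rw [Real.norm_eq_abs, abs_of_nonneg (hJ0 ω)]; exact hJu ω)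
  refine ⟨hJi, (integral_mono hJi hui hJu).trans ?_⟩
  have hS : MeasurableSet {ω | ε ≤ gridError l K T h n (gridPath B s h ω)} :=
    measurableSet_le measurable_const (measurable_gridError l K T h n fun j _ =>
      (hBm _).mono (𝓖.le _) le_rfl)
  set g : Ω → ℝ := fun ω => 1 + C * expProcess σ B (s + n * h) ω with hg
  have hgi : Integrable g Q := (integrable_const _).add ((hN.integrable _).const_mul C)
  have hg0 : ∀ ω, 0 ≤ g ω := fun ω => by
    have := expProcess_pos σ B (s + n * h) ω
    positivity
  -- The martingale property moves every step to the common terminal time, so the indicators, whose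
  -- sum is at most 1, multiply a single integrable function g.
  have h1 : ∫ ω, u ω ∂Q = ∫ ω, (∑ k ∈ Finset.range n, j k ω) * g ω ∂Q := by
    have h2 : ∀ ω, (∑ k ∈ Finset.range n, j k ω) * g ω = ∑ k ∈ Finset.range n,
        (j k ω + C * (expProcess σ B (s + n * h) ω • j k ω)) := fun ω => by
      rw [Finset.sum_mul]
      refine Finset.sum_congr rfl fun k _ => ?_
      rw [smul_eq_mul, hg]; ring
    simp_rw [h2]
    have ia : ∀ k ∈ Finset.range n, Integrable
        (fun ω => j k ω + C * (expProcess σ B (s + k * h + h) ω • j k ω)) Q := fun k hk =>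
      (hji k).add ((hmart k hk).2.1.const_mul C)
    have ib : ∀ k ∈ Finset.range n, Integrable
        (fun ω => j k ω + C * (expProcess σ B (s + n * h) ω • j k ω)) Q := fun k hk =>
      (hji k).add ((hmart k hk).1.const_mul C)
    rw [hu, integral_finsetSum _ ia, integral_finsetSum _ ib]
    refine Finset.sum_congr rfl fun k hk => ?_
    rw [integral_add (hji k) ((hmart k hk).2.1.const_mul C),
      integral_add (hji k) ((hmart k hk).1.const_mul C), integral_const_mul, integral_const_mul,
      (hmart k hk).2.2]
  rw [h1, ← integral_indicator hS]
  have hpt : ∀ ω, (∑ k ∈ Finset.range n, j k ω) * g ω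
      ≤ {ω | ε ≤ gridError l K T h n (gridPath B s h ω)}.indicator g ω := fun ω => by
    by_cases hω : ε ≤ gridError l K T h n (gridPath B s h ω)
    · rw [Set.indicator_of_mem (by exact hω)]
      exact mul_le_of_le_one_left (hg0 ω) (sum_jumpIndicator_le _ _ _ _)
    · rw [Set.indicator_of_notMem (by exact hω)]
      -- A single jump pushes the grid error above 1 ≥ ε, so outside the event there is none.
      have : ∑ k ∈ Finset.range n, j k ω = 0 := Finset.sum_eq_zero fun k hk => by
        simp only [hj, jumpIndicator, ite_eq_right_iff, one_ne_zero, imp_false, not_and, not_lt]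
        intro _
        by_contra! hlt
        exact hω (hε.trans (one_le_gridError_of_jump h.coe_nonneg (Finset.mem_range.1 hk) hlt).le)
      rw [this, zero_mul]
  refine integral_mono_of_nonneg (ae_of_all _ fun ω => mul_nonneg
    (Finset.sum_nonneg fun k _ => jumpIndicator_nonneg _ _ _ _) (hg0 ω)) (hgi.indicator hS)
    (ae_of_all _ hpt)

end Levy

/-! ### Refining the grid: conditional characteristic functions -/

section LevyLimit

variable {Ω : Type*} {m : MeasurableSpace Ω} {P Q : Measure Ω} {𝓖 : Filtration ℝ≥0 m}
  {W B : ℝ≥0 → Ω → ℝ} {θ σ : ℝ}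

lemma phaseFactor_gridPath (l : ℝ) (s : ℝ≥0) {h T : ℝ≥0} {n : ℕ} (hnT : n * h = T) (ω : Ω) :
    phaseFactor l h (gridPath B s h ω) n
      = Complex.exp (Complex.I * l * ((B (s + T) ω - B s ω : ℝ) : ℂ) + ((l ^ 2 / 2 * T : ℝ) : ℂ)) := by
  have h1 : (n : ℝ) * (h : ℝ) = T := by exact_mod_cast hnT
  simp only [phaseFactor, gridPath, hnT, h1]
  congr 1
  push_cast
  simp

/-- The error in the martingale property of the phase process, in terms of the grid error. -/
lemma exists_norm_setIntegral_phase_sub_one_le [IsProbabilityMeasure Q] (hσ : 0 < σ)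
    (hBm : ∀ t, Measurable[𝓖 t] (B t)) (hN : Martingale (expProcess σ B) 𝓖 Q) (l : ℝ) (s T : ℝ≥0) :
    ∃ C : ℝ, 0 ≤ C ∧ ∀ (A : Set Ω), MeasurableSet[𝓖 s] A → ∀ (H : Set Ω), MeasurableSet H →
      ∀ K : ℝ, (∀ ω, ω ∉ H → ∀ t ≤ s + T, |B t ω| ≤ K) → ∀ ε : ℝ, 0 < ε → ε ≤ 1 →
      ∀ (h : ℝ≥0) (n : ℕ), h ≤ 1 → n * h = T →
      ‖∫ ω in A, (Complex.exp (Complex.I * l * ((B (s + T) ω - B s ω : ℝ) : ℂ)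
          + ((l ^ 2 / 2 * T : ℝ) : ℂ)) - 1) ∂Q‖
        ≤ C * (ε + Q.real {ω | ε ≤ gridError l K T h n (gridPath B s h ω)} + Q.real H
          + ∫ ω in {ω | ε ≤ gridError l K T h n (gridPath B s h ω)},
            (1 + Real.exp (σ * K + σ ^ 2 / 2 * (s + T : ℝ≥0)) * expProcess σ B (s + T) ω) ∂Q) := by
  obtain ⟨C, hC, hCb⟩ := exists_norm_phaseFactor_sub_integral_le l hσ T.coe_nonneg
  refine ⟨C, hC, fun A hA H hH K hK ε hε hε1 h n hh hnT => ?_⟩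
  have hAm : MeasurableSet A := 𝓖.le s A hA
  have hnT' : (n : ℝ) * (h : ℝ) = T := by exact_mod_cast hnT
  have hBm' : ∀ t, Measurable (B t) := fun t => (hBm t).mono (𝓖.le t) le_rfl
  set f : ℕ → Ω → ℂ := fun k ω => (moderateIndicator K T (gridPath B s h ω) k : ℂ) *
        (phaseFactor l h (gridPath B s h ω) k * (Complex.I * l / σ *
          ((Real.exp (σ * (gridPath B s h ω (k + 1) - gridPath B s h ω k)
            - σ ^ 2 / 2 * h) - 1 : ℝ) : ℂ))) with hf
  have hf0 : ∀ k ∈ Finset.range n, IntegrableOn (f k) A Q ∧ ∫ ω in A, f k ω ∂Q = 0 := fun k hk =>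
    setIntegral_integral_term_eq_zero hσ hBm hN l K s h hnT' hA (Finset.mem_range.1 hk)
  set Bad : Set Ω := {ω | ε ≤ gridError l K T h n (gridPath B s h ω)} with hBad
  have hBadm : MeasurableSet Bad := measurableSet_le measurable_const
    (measurable_gridError l K T h n fun j _ => hBm' _)
  obtain ⟨hJi, hJb⟩ := integral_jump_le hσ hBm hN l K T s h n hε1
  rw [hnT] at hJb
  set J : Ω → ℝ := fun ω => ∑ k ∈ Finset.range n, jumpIndicator K T (gridPath B s h ω) k *
      (1 + Real.exp (σ * (gridPath B s h ω (k + 1) - gridPath B s h ω k) - σ ^ 2 / 2 * h)) with hJ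
  have hJ0 : ∀ ω, 0 ≤ J ω := fun ω => Finset.sum_nonneg fun k _ =>
    mul_nonneg (jumpIndicator_nonneg _ _ _ _) (by positivity)
  set M : Ω → ℂ := fun ω => Complex.exp (Complex.I * l * ((B (s + T) ω - B s ω : ℝ) : ℂ)
          + ((l ^ 2 / 2 * T : ℝ) : ℂ)) with hM
  have hMm : Measurable M := by
    refine Complex.measurable_exp.comp ?_
    exact ((Complex.measurable_ofReal.comp ((hBm' _).sub (hBm' _))).const_mul _).add_const _
  have hMph : ∀ ω, M ω = phaseFactor l h (gridPath B s h ω) n := fun ω =>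
    (phaseFactor_gridPath l s hnT ω).symm
  have hMi : Integrable M Q := Integrable.of_bound hMm.aestronglyMeasurable
    (Real.exp (l ^ 2 / 2 * T)) (ae_of_all _ fun ω => by
      rw [hMph]; exact norm_phaseFactor_le l h.coe_nonneg hnT' le_rfl _)
  set rest : Ω → ℂ := fun ω => M ω - 1 - ∑ k ∈ Finset.range n, f k ω with hrest
  -- Good paths cost ε; on `Bad` or `H` only the crude bound 1 + J is available.
  set bound : Ω → ℝ := fun ω => C * (ε + Bad.indicator 1 ω + H.indicator 1 ω + J ω) with hbound
  have hb0 : ∀ (S : Set Ω) ω, 0 ≤ S.indicator (1 : Ω → ℝ) ω := fun S ω =>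
    Set.indicator_nonneg (fun _ _ => zero_le_one) ω
  have hpt : ∀ ω, ‖rest ω‖ ≤ bound ω := fun ω => by
    obtain ⟨r1, r2⟩ := hCb K h n (gridPath B s h ω) h.coe_nonneg (by exact_mod_cast hh) hnT'
    have hr : rest ω = phaseFactor l h (gridPath B s h ω) n - 1 - ∑ k ∈ Finset.range n, f k ω := by
      rw [hrest, ← hMph]
    rw [hr]
    by_cases hcase : ω ∈ Bad ∨ ω ∈ H
    · refine r1.trans (mul_le_mul_of_nonneg_left ?_ hC)
      have : 1 ≤ Bad.indicator (1 : Ω → ℝ) ω + H.indicator (1 : Ω → ℝ) ω := by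
        rcases hcase with h1 | h1
        · rw [Set.indicator_of_mem h1]; exact le_add_of_nonneg_right (hb0 _ _)
        · rw [Set.indicator_of_mem h1 (1 : Ω → ℝ)]; exact le_add_of_nonneg_left (hb0 _ _)
      change 1 + J ω ≤ _
      linarith
    · rw [not_or] at hcase
      have he : gridError l K T h n (gridPath B s h ω) < ε := not_le.1 hcase.1
      have hmod : ModerateUpTo K T (gridPath B s h ω) n :=
        moderateUpTo_of_gridError_le h.coe_nonneg hnT' (fun j hj => hK ω hcase.2 _ (by
          rw [← hnT]; gcongr)) (he.le.trans hε1)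
      refine (r2 hmod).trans (mul_le_mul_of_nonneg_left ?_ hC)
      have h1 := abs_nonneg (∑ k ∈ Finset.range n,
        ((gridPath B s h ω (k + 1) - gridPath B s h ω k) ^ 2 - (h : ℝ)))
      have h2 := hb0 Bad ω
      have h3 := hb0 H ω
      have h4 := hJ0 ω
      unfold gridError at he
      linarith
  have hind : ∀ S : Set Ω, MeasurableSet S → Integrable (S.indicator (1 : Ω → ℝ)) Q := fun S hS =>
    (integrable_const (1 : ℝ)).indicator hS
  have i1 : Integrable (fun ω => ε + Bad.indicator (1 : Ω → ℝ) ω) Q :=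
    (integrable_const _).add (hind _ hBadm)
  have i2 : Integrable (fun ω => ε + Bad.indicator (1 : Ω → ℝ) ω + H.indicator (1 : Ω → ℝ) ω) Q :=
    i1.add (hind _ hH)
  have hboundi : Integrable bound Q := (i2.add hJi).const_mul C
  have hMA : ∫ ω in A, (M ω - 1) ∂Q = ∫ ω in A, rest ω ∂Q := by
    have e1 : IntegrableOn (fun ω => M ω - 1) A Q := (hMi.sub (integrable_const _)).integrableOn
    have e2 : IntegrableOn (fun ω => ∑ k ∈ Finset.range n, f k ω) A Q :=
      integrable_finsetSum _ fun k hk => (hf0 k hk).1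
    rw [hrest, integral_sub e1 e2, integral_finsetSum _ fun k hk => (hf0 k hk).1,
      Finset.sum_eq_zero fun k hk => (hf0 k hk).2, sub_zero]
  rw [hMA]
  refine (norm_integral_le_of_norm_le hboundi.integrableOn (ae_of_all _ hpt)).trans ?_
  refine (setIntegral_le_integral hboundi (ae_of_all _ fun ω => (norm_nonneg _).trans (hpt ω))).trans ?_
  rw [hbound, integral_const_mul, integral_add i2 hJi, integral_add i1 (hind _ hH),
    integral_add (integrable_const _) (hind _ hBadm), integral_indicator_one hBadm,
    integral_indicator_one hH]
  simp only [integral_const, probReal_univ, one_smul]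
  gcongr

/-- **Lévy's characterization**, on the level of conditional characteristic functions: if `B` is a
`P`-Brownian motion with drift and its exponential process is a `Q`-martingale, for a measure `Q`
which is absolutely continuous up to any finite time, then the increments of `B` have under `Q`
the conditional characteristic functions of a Brownian motion. -/
theorem setIntegral_cexp_increment [IsProbabilityMeasure P] [IsProbabilityMeasure Q]
    (hW : HasBrownianIncrements W 𝓖 P) (hB : ∀ t ω, B t ω = W t ω + θ * t)
    (hc : ∀ ω, Continuous fun t => B t ω) (hQP : ∀ t, Q.trim (𝓖.le t) ≪ P.trim (𝓖.le t))
    (hσ : 0 < σ) (hN : Martingale (expProcess σ B) 𝓖 Q) (l : ℝ) (s T : ℝ≥0) {A : Set Ω}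
    (hA : MeasurableSet[𝓖 s] A) :
    ∫ ω in A, Complex.exp (Complex.I * l * ((B (s + T) ω - B s ω : ℝ) : ℂ)) ∂Q
      = Q.real A * Complex.exp ((-(l ^ 2 / 2 * T) : ℝ) : ℂ) := by
  have hBm : ∀ t, Measurable[𝓖 t] (B t) := fun t => by
    have : B t = fun ω => W t ω + θ * t := funext (hB t)
    rw [this]; exact (hW.measurable t).add_const _
  have hBm' : ∀ t, Measurable (B t) := fun t => (hBm t).mono (𝓖.le t) le_rfl
  obtain ⟨C, hC, hCb⟩ := exists_norm_setIntegral_phase_sub_one_le hσ hBm hN l s T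
  obtain ⟨D, hD⟩ := exists_integral_gridError_le hW hB l T.coe_nonneg
  obtain ⟨H, hHm, hHb, hH0⟩ := exists_tendsto_measure_unbounded (Q := Q) hBm' hc (s + T)
  set Z := ‖∫ ω in A, (Complex.exp (Complex.I * l * ((B (s + T) ω - B s ω : ℝ) : ℂ)
          + ((l ^ 2 / 2 * T : ℝ) : ℂ)) - 1) ∂Q‖ with hZ
  set h : ℕ → ℝ≥0 := fun n => T / n with hh
  have hh0 : Tendsto h atTop (𝓝 0) := tendsto_const_div_atTop_nhds_zero_nat T
  have hev : ∀ᶠ n : ℕ in atTop, h n ≤ 1 ∧ (n : ℝ≥0) * h n = T := by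
    filter_upwards [hh0.eventually_le_const (zero_lt_one), eventually_gt_atTop 0] with n h1 h2
    refine ⟨h1, mul_div_cancel₀ _ ?_⟩
    exact_mod_cast h2.ne'
  -- The limits are taken in the order n → ∞, K → ∞, ε → 0: the weight exp(σK + …) grows with K, so
  -- K must stay fixed while the grid is refined.
  have hstep : ∀ (K : ℕ) (ε : ℝ), 0 < ε → ε ≤ 1 → Z ≤ C * (ε + Q.real (H K)) := by
    intro K ε hε hε1
    set E : ℕ → Set Ω := fun n => {ω | ε ≤ gridError l K T (h n) n (gridPath B s (h n) ω)} with hE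
    have hP : Tendsto (fun n => P (E n)) atTop (𝓝 0) := by
      refine tendsto_measureReal_le_zero (fun n ω => gridError_nonneg l K T (h n).coe_nonneg n _)
        ?_ ?_ hε
      · filter_upwards [hev] with n hn
        exact (hD K s (h n) n hn.1 (by exact_mod_cast hn.2)).1
      · have hlim : Tendsto (fun n => D * √(h n : ℝ)) atTop (𝓝 0) := by
          have h1 : Tendsto (fun n => ((h n : ℝ≥0) : ℝ)) atTop (𝓝 0) := by
            simpa using NNReal.tendsto_coe.2 hh0
          have h2 := (Real.continuous_sqrt.tendsto 0).comp h1
          simpa using h2.const_mul D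
        refine squeeze_zero' (.of_forall fun n => integral_nonneg fun ω =>
          gridError_nonneg l K T (h n).coe_nonneg n _) ?_ hlim
        filter_upwards [hev] with n hn
        exact (hD K s (h n) n hn.1 (by exact_mod_cast hn.2)).2
    have hev' : ∀ᶠ n : ℕ in atTop, n * h n = T := hev.mono fun n hn => hn.2
    -- The identity n h_n = T, which places the grid inside [s, s + T], may fail for n = 0 since T /
    -- 0 = 0. Emptying the event there makes all of them measurable at time s + T, where Q is
    -- compared with P.
    set E' : ℕ → Set Ω := fun n => if n * h n = T then E n else ∅ with hE'
    have hEE' : ∀ᶠ n in atTop, E' n = E n := by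
      filter_upwards [hev'] with n hn; simp [hE', hn]
    have hE'm : ∀ n, MeasurableSet[𝓖 (s + T)] (E' n) := fun n => by
      by_cases hn : n * h n = T
      · simp only [hE', hn, if_true]
        refine @measurable_gridError Ω (𝓖 (s + T)) l K T (h n) n (gridPath B s (h n)) (fun j hj => ?_)
          _ measurableSet_Ici
        exact (hBm _).mono (𝓖.mono (by rw [← hn]; gcongr)) le_rfl
      · simp [hE', hn]
    have hQ' : Tendsto (fun n => Q (E' n)) atTop (𝓝 0) :=
      tendsto_measure_zero_of_trim_absolutelyContinuous (𝓖.le _) (hQP _) hE'm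
        (hP.congr' (hEE'.mono fun n hn => by simp only [hn]))
    have hQ : Tendsto (fun n => Q (E n)) atTop (𝓝 0) :=
      hQ'.congr' (hEE'.mono fun n hn => by simp only [hn])
    have hQr : Tendsto (fun n => Q.real (E n)) atTop (𝓝 0) :=
      (ENNReal.tendsto_toReal ENNReal.zero_ne_top).comp hQ
    have hgi : Integrable (fun ω => 1 + Real.exp (σ * K + σ ^ 2 / 2 * (s + T : ℝ≥0))
        * expProcess σ B (s + T) ω) Q :=
      (integrable_const _).add ((hN.integrable _).const_mul _)
    have hint := hgi.tendsto_setIntegral_nhds_zero hQ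
    have hlim := (((hQr.const_add ε).add_const (Q.real (H K))).add hint).const_mul C
    rw [add_zero, add_zero] at hlim
    refine ge_of_tendsto hlim ?_
    filter_upwards [hev] with n hn
    exact hCb A hA (H K) (hHm K) K (hHb K) ε hε hε1 (h n) n hn.1 hn.2
  have hstep2 : ∀ ε : ℝ, 0 < ε → ε ≤ 1 → Z ≤ C * ε := fun ε hε hε1 => by
    have hlim := (hH0.const_add ε).const_mul C
    rw [add_zero] at hlim
    exact ge_of_tendsto' hlim fun K => hstep K ε hε hε1
  have hZ0 : Z ≤ 0 := by
    by_contra! hpos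
    have h1 : 0 < min 1 (Z / (2 * (C + 1))) := lt_min one_pos (by positivity)
    have h2 := hstep2 _ h1 (min_le_left _ _)
    have h3 : C * min 1 (Z / (2 * (C + 1))) ≤ C * (Z / (2 * (C + 1))) :=
      mul_le_mul_of_nonneg_left (min_le_right _ _) hC
    have h4 : C * (Z / (2 * (C + 1))) < Z := by
      rw [← mul_div_assoc, div_lt_iff₀ (by positivity)]
      nlinarith
    linarith
  have hZeq := norm_le_zero_iff.1 hZ0
  set g : Ω → ℂ := fun ω => Complex.exp (Complex.I * l * ((B (s + T) ω - B s ω : ℝ) : ℂ)) with hg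
  have hgm : Measurable g := Complex.measurable_exp.comp
    ((Complex.measurable_ofReal.comp ((hBm' _).sub (hBm' _))).const_mul _)
  have hgi : Integrable g Q := Integrable.of_bound hgm.aestronglyMeasurable 1 (ae_of_all _ fun ω => by
    have : Complex.I * l * ((B (s + T) ω - B s ω : ℝ) : ℂ)
        = ((l * (B (s + T) ω - B s ω) : ℝ) : ℂ) * Complex.I := by push_cast; ring
    simp only [hg, this, Complex.norm_exp_ofReal_mul_I, le_refl])
  simp_rw [Complex.exp_add] at hZeq
  rw [integral_sub (by exact (hgi.mul_const _).integrableOn) (integrable_const _),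
    integral_mul_const, sub_eq_zero] at hZeq
  rw [Complex.ofReal_neg, Complex.exp_neg, ← div_eq_mul_inv, eq_div_iff (Complex.exp_ne_zero _), hZeq]
  simp

end LevyLimit

/-! ### From characteristic functions to Brownian motion -/

section QBrownian

variable {Ω : Type*} {m : MeasurableSpace Ω} {P Q : Measure Ω} {𝓖 : Filtration ℝ≥0 m}
  {W B : ℝ≥0 → Ω → ℝ} {θ σ : ℝ}

/-- Finite measures are determined by their characteristic functions. Restricting Q to A makes this
a statement on the law of D conditional on A. -/
lemma restrict_map_eq_smul_gaussianReal [IsProbabilityMeasure Q] {D : Ω → ℝ} (hD : Measurable D)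
    {T : ℝ≥0} {A : Set Ω}
    (h : ∀ l : ℝ, ∫ ω in A, Complex.exp (Complex.I * l * (D ω : ℂ)) ∂Q
      = Q.real A * Complex.exp ((-(l ^ 2 / 2 * T) : ℝ) : ℂ)) :
    (Q.restrict A).map D = Q A • gaussianReal 0 T := by
  have : IsFiniteMeasure (Q A • gaussianReal 0 T) :=
    ⟨by simp⟩
  refine Measure.ext_of_charFun (funext fun l => ?_)
  have e1 : charFun (Q A • gaussianReal 0 T) l
      = (Q.real A : ℂ) * charFun (gaussianReal 0 T) l := by
    rw [charFun_apply_real, charFun_apply_real, integral_smul_measure]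
    simp [Measure.real]
  rw [e1, charFun_gaussianReal, charFun_apply_real,
    integral_map hD.aemeasurable (by fun_prop)]
  calc _ = ∫ ω in A, Complex.exp (Complex.I * l * (D ω : ℂ)) ∂Q := by
        congr 1 with ω; congr 1; ring
    _ = _ := by
        rw [h l]; congr 2; push_cast; ring

/-- **Lévy's characterization**: a Brownian motion with drift whose exponential process is a
martingale under a locally absolutely continuous measure is a Brownian motion under it. -/
theorem HasBrownianIncrements.of_martingale_expProcess [IsProbabilityMeasure P]
    [IsProbabilityMeasure Q]
    (hW : HasBrownianIncrements W 𝓖 P) (hB : ∀ t ω, B t ω = W t ω + θ * t)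
    (hc : ∀ ω, Continuous fun t => B t ω) (hQP : ∀ t, Q.trim (𝓖.le t) ≪ P.trim (𝓖.le t))
    (hσ : 0 < σ) (hN : Martingale (expProcess σ B) 𝓖 Q) : HasBrownianIncrements B 𝓖 Q := by
  have hBm : ∀ t, Measurable[𝓖 t] (B t) := fun t => by
    have : B t = fun ω => W t ω + θ * t := funext (hB t)
    rw [this]; exact (hW.measurable t).add_const _
  have hDm : ∀ s h, Measurable (fun ω => B (s + h) ω - B s ω) := fun s h =>
    ((hBm _).mono (𝓖.le _) le_rfl).sub ((hBm _).mono (𝓖.le _) le_rfl)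
  -- A = Ω gives the Gaussian law of the increment, general past events A its independence of the
  -- past.
  have key : ∀ s h A, MeasurableSet[𝓖 s] A →
      (Q.restrict A).map (fun ω => B (s + h) ω - B s ω) = Q A • gaussianReal 0 h := fun s h A hA =>
    restrict_map_eq_smul_gaussianReal (hDm s h) fun l =>
      setIntegral_cexp_increment hW hB hc hQP hσ hN l s h hA
  have hlaw : ∀ s h, Q.map (fun ω => B (s + h) ω - B s ω) = gaussianReal 0 h := fun s h => by
    have := key s h Set.univ MeasurableSet.univ
    rwa [Measure.restrict_univ, measure_univ, one_smul] at this
  refine ⟨hBm, fun s h => ⟨(hDm s h).aemeasurable, hlaw s h⟩, fun s h => ?_⟩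
  rw [Indep_iff]
  rintro _ A ⟨S, hS, rfl⟩ hA
  have h1 := congrArg (fun μ => μ S) (key s h A hA)
  simp only [Measure.smul_apply, smul_eq_mul] at h1
  rw [Measure.map_apply (hDm s h) hS, Measure.restrict_apply (hDm s h hS)] at h1
  rw [h1, ← hlaw s h, Measure.map_apply (hDm s h) hS, mul_comm]

/-- Induction on the largest index: all earlier variables are measurable with respect to the
σ-algebra of which the last one is independent. -/
lemma iIndepFun_of_indep_filtration [IsProbabilityMeasure Q] (ℱ : Filtration ℕ m)
    {f : ℕ → Ω → ℝ} (hf : ∀ k, Measurable[ℱ (k + 1)] (f k))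
    (hind : ∀ k, Indep (MeasurableSpace.comap (f k) inferInstance) (ℱ k) Q) : iIndepFun f Q := by
  rw [iIndepFun_iff_measure_inter_preimage_eq_mul]
  intro S
  induction S using Finset.induction_on_max with
  | empty => simp
  | insert a S hlt ih =>
    intro sets hsets
    have ha : a ∉ S := fun h => lt_irrefl a (hlt a h)
    rw [Finset.set_biInter_insert, Finset.prod_insert ha,
      ← ih fun i hi => hsets i (Finset.mem_insert_of_mem hi)]
    refine (Indep_iff _ _ _).1 (hind a) _ _ ⟨_, hsets a (Finset.mem_insert_self a S), rfl⟩ ?_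
    refine Finset.measurableSet_biInter S fun i hi => ?_
    exact ((hf i).mono (ℱ.mono (hlt i hi)) le_rfl) (hsets i (Finset.mem_insert_of_mem hi))

lemma HasBrownianIncrements.isPreBrownianReal [IsProbabilityMeasure Q]
    (hB : HasBrownianIncrements B 𝓖 Q) (h0 : ∀ᵐ ω ∂Q, B 0 ω = 0) : IsPreBrownianReal B Q := by
  refine HasIndepIncrements.isPreBrownianReal_of_hasLaw (fun t => ?_) ?_
  · refine (hB.law 0 t).congr ?_
    filter_upwards [h0] with ω hω
    simp [hω]
  · rw [hasIndepIncrements_iff_nat]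
    intro t ht
    refine iIndepFun_of_indep_filtration
      { seq := fun k => 𝓖 (t k), mono' := fun i j hij => 𝓖.mono (ht hij), le' := fun k => 𝓖.le _ }
      (fun k => ?_) (fun k => ?_)
    · exact (hB.measurable _).sub ((hB.measurable _).mono (𝓖.mono (ht k.le_succ)) le_rfl)
    · obtain ⟨h, hh⟩ := exists_add_of_le (ht k.le_succ)
      have := hB.indep (t k) h
      rwa [← hh] at this

lemma IsPreBrownianReal.hasBrownianIncrements (hW : IsPreBrownianReal W P)
    (hm : ∀ t, Measurable (W t)) :
    HasBrownianIncrements W (Filtration.natural W fun t => (hm t).stronglyMeasurable) P := by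
  refine ⟨fun t => ?_, fun s h => ?_, fun s h => ?_⟩
  · exact (Filtration.stronglyAdapted_natural (fun t => (hm t).stronglyMeasurable) t).measurable
  · exact (hW.shift s).hasLaw_eval h
  · have h1 := hW.indepFun_shift s
    rw [IndepFun_iff_Indep] at h1
    rw [Filtration.natural_eq_comap]
    refine indep_of_indep_of_le_left h1 ?_
    have : (fun ω => W (s + h) ω - W s ω)
        = (fun x : ℝ≥0 → ℝ => x h) ∘ (fun ω t => W (s + t) ω - W s ω) := rfl
    rw [this, ← MeasurableSpace.comap_comp]
    exact MeasurableSpace.comap_mono (measurable_pi_apply h).comap_le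

/-- A normalized linear combination of two independent Brownian motions is a Brownian motion. -/
lemma IsPreBrownianReal.linearCombination {W₁ W₂ : ℝ≥0 → Ω → ℝ} (hW₁ : IsPreBrownianReal W₁ P)
    (hW₂ : IsPreBrownianReal W₂ P) (hind : IndepFun (fun ω t => W₁ t ω) (fun ω t => W₂ t ω) P)
    {a b : ℝ} (hab : a ^ 2 + b ^ 2 = 1) :
    IsPreBrownianReal (fun t ω => a * W₁ t ω + b * W₂ t ω) P := by
  have : IsProbabilityMeasure P := hW₁.isGaussianProcess.isProbabilityMeasure
  have m₁ : ∀ t, MemLp (W₁ t) 2 P := fun t => (hW₁.isGaussianProcess.hasGaussianLaw_eval t).memLp_two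
  have m₂ : ∀ t, MemLp (W₂ t) 2 P := fun t => (hW₂.isGaussianProcess.hasGaussianLaw_eval t).memLp_two
  refine IsGaussianProcess.isPreBrownianReal_of_covariance ⟨fun I => ?_⟩ (fun t => ?_)
    (fun s t hst => ?_)
  · have hI : IndepFun (fun ω => I.restrict (W₁ · ω)) (fun ω => I.restrict (W₂ · ω)) P :=
      hind.comp (φ := fun x => I.restrict x) (ψ := fun x => I.restrict x)
        (measurable_pi_lambda _ fun i => measurable_pi_apply _)
        (measurable_pi_lambda _ fun i => measurable_pi_apply _)
    have hg := hI.hasGaussianLaw (hW₁.isGaussianProcess.hasGaussianLaw I)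
      (hW₂.isGaussianProcess.hasGaussianLaw I)
    exact hg.map (a • ContinuousLinearMap.fst ℝ (I → ℝ) (I → ℝ)
      + b • ContinuousLinearMap.snd ℝ (I → ℝ) (I → ℝ))
  · rw [integral_add ((hW₁.integrable_eval t).const_mul a) ((hW₂.integrable_eval t).const_mul b),
      integral_const_mul, integral_const_mul, hW₁.integral_eval, hW₂.integral_eval]
    simp
  · have hcross : ∀ s t, cov[W₁ s, W₂ t; P] = 0 := fun s t =>
      IndepFun.covariance_eq_zero (hind.comp (φ := fun x : ℝ≥0 → ℝ => x s)
        (ψ := fun x : ℝ≥0 → ℝ => x t) (measurable_pi_apply s) (measurable_pi_apply t)) (m₁ s) (m₂ t)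
    have e : ∀ t, (fun ω => a * W₁ t ω + b * W₂ t ω) = a • W₁ t + b • W₂ t := fun t => rfl
    have n₁ : ∀ t, MemLp (a • W₁ t) 2 P := fun t => (m₁ t).const_smul a
    have n₂ : ∀ t, MemLp (b • W₂ t) 2 P := fun t => (m₂ t).const_smul b
    rw [e s, e t, covariance_add_left (n₁ s) (n₂ s) ((n₁ t).add (n₂ t)),
      covariance_add_right (n₁ s) (n₁ t) (n₂ t), covariance_add_right (n₂ s) (n₁ t) (n₂ t)]
    simp only [covariance_smul_left, covariance_smul_right, hcross, covariance_comm (W₂ s),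
      hW₁.covariance_eval, hW₂.covariance_eval, min_eq_left hst, min_eq_right hst]
    linear_combination (s : ℝ) * hab

end QBrownian

/-! ### Passage probabilities in discrete time -/

section DiscretePassage

variable {Ω : Type*} {m : MeasurableSpace Ω} {Q : Measure Ω}
  {ℱ : Filtration ℕ m} {N : ℕ → Ω → ℝ}

/-- The event that the process `N` reaches the level `y` for the first time at time `j`. -/
def firstPassage (N : ℕ → Ω → ℝ) (y : ℝ) (j : ℕ) : Set Ω := {ω | y ≤ N j ω ∧ ∀ i < j, N i ω < y}

lemma measurableSet_firstPassage (hN : ∀ k, Measurable[ℱ k] (N k)) (y : ℝ) (j : ℕ) :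
    MeasurableSet[ℱ j] (firstPassage N y j) := by
  refine MeasurableSet.inter (hN j measurableSet_Ici) ?_
  change MeasurableSet[ℱ j] {ω | ∀ i < j, N i ω < y}
  simp only [Set.ofPred_forall]
  exact .iInter fun i => .iInter fun hi => ((hN i).mono (ℱ.mono hi.le) le_rfl) measurableSet_Iio

lemma pairwiseDisjoint_firstPassage (N : ℕ → Ω → ℝ) (y : ℝ) (s : Set ℕ) :
    s.PairwiseDisjoint (firstPassage N y) := by
  intro i _ j _ hij
  rw [Function.onFun, Set.disjoint_left]
  intro ω hi hj
  rcases lt_or_gt_of_ne hij with h | h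
  · exact absurd hi.1 (not_le.2 (hj.2 i h))
  · exact absurd hj.1 (not_le.2 (hi.2 j h))

lemma biUnion_firstPassage (N : ℕ → Ω → ℝ) (y : ℝ) (n : ℕ) :
    ⋃ j ∈ Finset.range (n + 1), firstPassage N y j = {ω | ∃ j ≤ n, y ≤ N j ω} := by
  ext ω
  simp only [Set.mem_iUnion, Finset.mem_range, Nat.lt_succ_iff, exists_prop, Set.mem_ofPred_eq]
  constructor
  · rintro ⟨j, hj, h⟩; exact ⟨j, hj, h.1⟩
  · intro h
    classical
    have h' : ∃ j, y ≤ N j ω := ⟨_, h.choose_spec.2⟩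
    refine ⟨Nat.find h', (Nat.find_min' h' h.choose_spec.2).trans h.choose_spec.1,
      Nat.find_spec h', fun i hi => not_le.1 (Nat.find_min h' hi)⟩

lemma setIntegral_exists_le (hN : ∀ k, Measurable[ℱ k] (N k))
    (y : ℝ) (n : ℕ) {f : Ω → ℝ} (hf : Integrable f Q) :
    ∫ ω in {ω | ∃ j ≤ n, y ≤ N j ω}, f ω ∂Q
      = ∑ j ∈ Finset.range (n + 1), ∫ ω in firstPassage N y j, f ω ∂Q := by
  rw [← biUnion_firstPassage]
  exact integral_biUnion_finset _ (fun j _ => ℱ.le j _ (measurableSet_firstPassage hN y j))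
    (pairwiseDisjoint_firstPassage N y _) (fun j _ => hf.integrableOn)

variable [IsProbabilityMeasure Q]

lemma measureReal_exists_le (hN : ∀ k, Measurable[ℱ k] (N k)) (y : ℝ) (n : ℕ) :
    Q.real {ω | ∃ j ≤ n, y ≤ N j ω} = ∑ j ∈ Finset.range (n + 1), Q.real (firstPassage N y j) := by
  rw [← biUnion_firstPassage]
  exact measureReal_biUnion_finset (pairwiseDisjoint_firstPassage N y _)
    (fun j _ => ℱ.le j _ (measurableSet_firstPassage hN y j))

/-- Doob's maximal inequality: on a first passage at j the terminal value has the same integral as N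
j, which is at least y there. -/
lemma mul_measureReal_exists_le_le (hN : ∀ k, Measurable[ℱ k] (N k)) (hi : ∀ k, Integrable (N k) Q)
    (h0 : ∀ k ω, 0 ≤ N k ω)
    (hmart : ∀ j k, j ≤ k → ∀ F, MeasurableSet[ℱ j] F → ∫ ω in F, N k ω ∂Q = ∫ ω in F, N j ω ∂Q)
    (y : ℝ) (n : ℕ) : y * Q.real {ω | ∃ j ≤ n, y ≤ N j ω} ≤ ∫ ω, N 0 ω ∂Q := by
  have h1 : ∫ ω, N n ω ∂Q = ∫ ω, N 0 ω ∂Q := by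
    simpa using hmart 0 n (Nat.zero_le n) Set.univ MeasurableSet.univ
  rw [← h1]
  refine le_trans ?_ (setIntegral_le_integral (s := {ω | ∃ j ≤ n, y ≤ N j ω}) (hi n)
    (ae_of_all _ (h0 n)))
  rw [setIntegral_exists_le hN y n (hi n), measureReal_exists_le hN, Finset.mul_sum]
  refine Finset.sum_le_sum fun j hj => ?_
  have hm := measurableSet_firstPassage hN y j
  rw [hmart j n (Nat.lt_succ_iff.1 (Finset.mem_range.1 hj)) _ hm]
  have := setIntegral_mono_on (integrable_const y).integrableOn (hi j).integrableOn (ℱ.le j _ hm)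
    (fun ω hω => hω.1)
  rwa [setIntegral_const, smul_eq_mul, mul_comm] at this

/-- The reverse bound. Without a passage N n equals its minimum with y; at a passage with N j ≤ y +
η the terminal value is replaced by N j; the remaining passages start above y or involve a step
larger than η, and are kept in the last integral. -/
lemma integral_le_add_overshoot (hN : ∀ k, Measurable[ℱ k] (N k)) (hi : ∀ k, Integrable (N k) Q)
    (h0 : ∀ k ω, 0 ≤ N k ω)
    (hmart : ∀ j k, j ≤ k → ∀ F, MeasurableSet[ℱ j] F → ∫ ω in F, N k ω ∂Q = ∫ ω in F, N j ω ∂Q)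
    {y η : ℝ} (hy : 0 ≤ y) (hη : 0 ≤ y + η) (n : ℕ) :
    ∫ ω, N 0 ω ∂Q ≤ ∫ ω, min (N n ω) y ∂Q + (y + η) * Q.real {ω | ∃ j ≤ n, y ≤ N j ω}
      + ∫ ω in {ω | y ≤ N 0 ω ∨ ∃ i < n, η < N (i + 1) ω - N i ω}, N n ω ∂Q := by
  have hNm : ∀ k, Measurable (N k) := fun k => (hN k).mono (ℱ.le k) le_rfl
  have h1 : ∫ ω, N 0 ω ∂Q = ∫ ω, N n ω ∂Q := by
    simpa using (hmart 0 n (Nat.zero_le n) Set.univ MeasurableSet.univ).symm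
  set H : Set Ω := {ω | ∃ j ≤ n, y ≤ N j ω} with hH
  have hHm : MeasurableSet H := by
    rw [hH, ← biUnion_firstPassage]
    exact Finset.measurableSet_biUnion _ fun j _ => ℱ.le j _ (measurableSet_firstPassage hN y j)
  set O : Set Ω := {ω | y ≤ N 0 ω ∨ ∃ i < n, η < N (i + 1) ω - N i ω} with hO
  have hOm : MeasurableSet O := by
    refine MeasurableSet.union (measurableSet_le measurable_const (hNm 0)) ?_
    change MeasurableSet {ω | ∃ i < n, η < N (i + 1) ω - N i ω}
    simp only [← exists_prop, Set.ofPred_exists]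
    exact .iUnion fun i => .iUnion fun _ =>
      measurableSet_lt measurable_const ((hNm (i + 1)).sub (hNm i))
  rw [h1, ← integral_add_compl hHm (hi n), add_assoc, add_comm]
  refine add_le_add ?_ ?_
  · have hmin : Integrable (fun ω => min (N n ω) y) Q := (hi n).inf (integrable_const y)
    refine le_trans (le_of_eq ?_) (setIntegral_le_integral (s := Hᶜ) hmin
      (ae_of_all _ fun ω => le_min (h0 n ω) hy))
    refine setIntegral_congr_fun hHm.compl fun ω hω => ?_
    have : N n ω < y := by
      by_contra! hle
      exact hω ⟨n, le_rfl, hle⟩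
    exact (min_eq_left this.le).symm
  · rw [setIntegral_exists_le hN y n (hi n), measureReal_exists_le hN, Finset.mul_sum]
    have hOi : ∫ ω in O ∩ H, N n ω ∂Q ≤ ∫ ω in O, N n ω ∂Q :=
      setIntegral_mono_set (hi n).integrableOn (ae_of_all _ (h0 n))
        (LE.le.eventuallyLE Set.inter_subset_left)
    refine le_trans ?_ (add_le_add_right hOi _)
    have hsplit : ∫ ω in O ∩ H, N n ω ∂Q
        = ∑ j ∈ Finset.range (n + 1), ∫ ω in O ∩ firstPassage N y j, N n ω ∂Q := by
      rw [hH, ← biUnion_firstPassage, Set.inter_iUnion₂]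
      refine integral_biUnion_finset _ (fun j _ =>
        hOm.inter (ℱ.le j _ (measurableSet_firstPassage hN y j))) ?_
        (fun j _ => (hi n).integrableOn)
      exact fun i hi j hj hij => (pairwiseDisjoint_firstPassage N y _ hi hj hij).mono
        Set.inter_subset_right Set.inter_subset_right
    rw [hsplit, ← Finset.sum_add_distrib]
    refine Finset.sum_le_sum fun j hj => ?_
    have hjn : j ≤ n := Nat.lt_succ_iff.1 (Finset.mem_range.1 hj)
    have hm := measurableSet_firstPassage hN y j
    set F := firstPassage N y j
    have hgood : MeasurableSet[ℱ j] {ω | N j ω ≤ y + η} := hN j measurableSet_Iic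
    rw [← integral_inter_add_sdiff (ℱ.le j _ hgood) (hi n).integrableOn]
    refine add_le_add ?_ ?_
    · rw [hmart j n hjn _ (hm.inter hgood)]
      have := setIntegral_mono_on (hi j).integrableOn (integrable_const (y + η)).integrableOn
        (ℱ.le j _ (hm.inter hgood)) (fun ω hω => hω.2)
      rw [setIntegral_const, smul_eq_mul, mul_comm] at this
      exact this.trans (mul_le_mul_of_nonneg_left (measureReal_mono Set.inter_subset_left) hη)
    · refine setIntegral_mono_set (hi n).integrableOn (ae_of_all _ (h0 n)) (LE.le.eventuallyLE ?_)
      rintro ω ⟨hF, hbad⟩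
      refine ⟨?_, hF⟩
      -- Before a first passage at j = i + 1 the value N i is below y, so exceeding y + η takes a
      -- step larger than η.
      cases j with
      | zero => exact Or.inl hF.1
      | succ i =>
        refine Or.inr ⟨i, hjn, ?_⟩
        have h2 := hF.2 i i.lt_succ_self
        have h3 : y + η < N (i + 1) ω := not_le.1 hbad
        linarith

end DiscretePassage

/-! ### Passage probabilities in continuous time -/

section ContinuousPassage

variable {Ω : Type*} {m : MeasurableSpace Ω} {Q : Measure Ω} [IsProbabilityMeasure Q]
  {𝓖 : Filtration ℝ≥0 m} {N : ℝ≥0 → Ω → ℝ} {y : ℝ}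

/-- A nonnegative continuous integrable process with the set-integral form of the martingale
property. -/
structure IsPathContinuousMartingale (N : ℝ≥0 → Ω → ℝ) (𝓖 : Filtration ℝ≥0 m) (Q : Measure Ω) :
    Prop where
  measurable : ∀ t, Measurable[𝓖 t] (N t)
  integrable : ∀ t, Integrable (N t) Q
  nonneg : ∀ t ω, 0 ≤ N t ω
  continuous : ∀ ω, Continuous fun t => N t ω
  setIntegral_eq : ∀ s t, s ≤ t → ∀ F, MeasurableSet[𝓖 s] F → ∫ ω in F, N t ω ∂Q = ∫ ω in F, N s ω ∂Q

/-- The grids of mesh 2^{-k} with endpoint 4^k · 2^{-k} = 2^k refine each other and exhaust the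
half-line. -/
lemma exists_dyadic_lt {f : ℝ≥0 → ℝ} (hf : Continuous f) {y' : ℝ} {u : ℝ≥0} (hu : y' < f u) :
    ∃ k j : ℕ, j ≤ 4 ^ k ∧ y' ≤ f (j * (1 / 2 ^ k)) := by
  have h1 : Tendsto (fun k : ℕ => (⌊(u : ℝ) * 2 ^ k⌋₊ : ℝ) / 2 ^ k) atTop (𝓝 u) :=
    (tendsto_nat_floor_mul_div_atTop u.coe_nonneg).comp
      (tendsto_pow_atTop_atTop_of_one_lt one_lt_two)
  have h2 : Tendsto (fun k : ℕ => ((⌊(u : ℝ) * 2 ^ k⌋₊ : ℝ≥0) * (1 / 2 ^ k) : ℝ≥0)) atTop (𝓝 u) := by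
    rw [← NNReal.tendsto_coe]
    refine h1.congr fun k => ?_
    push_cast
    ring
  have h3 := ((hf.tendsto u).comp h2).eventually_const_lt hu
  have h4 : ∀ᶠ k : ℕ in atTop, (u : ℝ) ≤ 2 ^ k :=
    (tendsto_pow_atTop_atTop_of_one_lt one_lt_two).eventually_ge_atTop _
  obtain ⟨k, h5, h6⟩ := (h3.and h4).exists
  refine ⟨k, _, ?_, h5.le⟩
  have : (u : ℝ) * 2 ^ k ≤ ((4 ^ k : ℕ) : ℝ) := by
    push_cast
    rw [show (4 : ℝ) = 2 * 2 by norm_num, mul_pow]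
    gcongr
  exact Nat.floor_le_of_le this

lemma IsPathContinuousMartingale.mul_measureReal_grid_le (hN : IsPathContinuousMartingale N 𝓖 Q)
    (y : ℝ) (d : ℝ≥0) (n : ℕ) :
    y * Q.real {ω | ∃ j ≤ n, y ≤ N (j * d) ω} ≤ ∫ ω, N 0 ω ∂Q := by
  have h := mul_measureReal_exists_le_le (Q := Q) (ℱ := gridFiltration 𝓖 0 d)
    (N := fun k ω => N (0 + k * d) ω) (fun k => hN.measurable _) (fun k => hN.integrable _)
    (fun k ω => hN.nonneg _ _) (fun j k hjk F hF => hN.setIntegral_eq _ _ (by gcongr) F hF) y n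
  simpa using h

/-- Maximal inequality over the whole time axis. -/
lemma IsPathContinuousMartingale.mul_measureReal_exists_le (hN : IsPathContinuousMartingale N 𝓖 Q)
    (hy : 0 < y) : y * Q.real {ω | ∃ u, y ≤ N u ω} ≤ ∫ ω, N 0 ω ∂Q := by
  -- A passage time of y need not be dyadic, but any lower level y' is then exceeded at some dyadic
  -- time; y' ↑ y at the end.
  have hlt : ∀ y' : ℝ, 0 < y' → y' < y → y' * Q.real {ω | ∃ u, y ≤ N u ω} ≤ ∫ ω, N 0 ω ∂Q := by
    intro y' hy' hyy
    set S : ℕ → Set Ω := fun k => {ω | ∃ j : ℕ, j ≤ 4 ^ k ∧ y' ≤ N (j * (1 / 2 ^ k)) ω} with hS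
    have hmono : Monotone S := monotone_nat_of_le_succ fun k ω hω => by
      obtain ⟨j, hj, hjy⟩ := hω
      refine ⟨2 * j, by rw [pow_succ]; linarith, ?_⟩
      have : ((2 * j : ℕ) : ℝ≥0) * (1 / 2 ^ (k + 1)) = j * (1 / 2 ^ k) := by
        rw [pow_succ]; push_cast; field_simp
      rwa [this]
    have hsub : {ω | ∃ u, y ≤ N u ω} ⊆ ⋃ k, S k := by
      rintro ω ⟨u, hu⟩
      obtain ⟨k, j, hj, hjy⟩ := exists_dyadic_lt (hN.continuous ω) (hyy.trans_le hu)
      exact Set.mem_iUnion.2 ⟨k, j, hj, hjy⟩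
    have htend : Tendsto (fun k => Q.real (S k)) atTop (𝓝 (Q.real (⋃ k, S k))) :=
      (ENNReal.tendsto_toReal (measure_ne_top _ _)).comp (tendsto_measure_iUnion_atTop hmono)
    have h1 := le_of_tendsto' (htend.const_mul y') fun k =>
      hN.mul_measureReal_grid_le y' (1 / 2 ^ k) (4 ^ k)
    exact (mul_le_mul_of_nonneg_left (measureReal_mono hsub) hy'.le).trans h1
  have h2 : Tendsto (fun y' : ℝ => y' * Q.real {ω | ∃ u, y ≤ N u ω}) (𝓝[<] y)
      (𝓝 (y * Q.real {ω | ∃ u, y ≤ N u ω})) :=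
    ((continuous_id.mul continuous_const).tendsto y).mono_left nhdsWithin_le_nhds
  refine le_of_tendsto h2 ?_
  filter_upwards [Ioo_mem_nhdsLT hy] with y' hy'
  exact hlt y' hy'.1 hy'.2

lemma eventually_forall_grid_sub_le {f : ℝ≥0 → ℝ} (hf : Continuous f) (T : ℝ≥0) {η : ℝ} (hη : 0 < η) :
    ∀ᶠ n : ℕ in atTop, ∀ i < n, f ((i + 1 : ℕ) * (T / n)) - f (i * (T / n)) ≤ η := by
  have huc := (isCompact_Icc (a := (0 : ℝ≥0)) (b := T)).uniformContinuousOn_of_continuous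
    hf.continuousOn
  rw [Metric.uniformContinuousOn_iff] at huc
  obtain ⟨r, hr, hrb⟩ := huc η hη
  have hT : Tendsto (fun n : ℕ => ((T / n : ℝ≥0) : ℝ)) atTop (𝓝 0) := by
    simpa using NNReal.tendsto_coe.2 (tendsto_const_div_atTop_nhds_zero_nat T)
  filter_upwards [hT.eventually_lt_const hr] with n hn i hi
  have hn0 : (n : ℝ≥0) ≠ 0 := by exact_mod_cast (Nat.zero_lt_of_lt hi).ne'
  have hmem : ∀ j ≤ n, (j : ℝ≥0) * (T / n) ∈ Set.Icc 0 T := fun j hj => by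
    refine ⟨zero_le, ?_⟩
    calc (j : ℝ≥0) * (T / n) ≤ n * (T / n) := by gcongr
      _ = T := mul_div_cancel₀ _ hn0
  have h1 := hrb _ (hmem (i + 1) hi) _ (hmem i hi.le) (by
    rw [NNReal.dist_eq]
    push_cast
    have : ((i : ℝ) + 1) * (T / n) - i * (T / n) = T / n := by ring
    rw [this, abs_of_nonneg (by positivity)]
    simpa using hn)
  rw [Real.dist_eq] at h1
  exact (le_abs_self _).trans h1.le

/-- By uniform continuity on [0, T], steps larger than η almost surely disappear on fine grids, and
integrability of N T removes the overshoot term. Then η ↓ 0. -/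
lemma IsPathContinuousMartingale.integral_le_add (hN : IsPathContinuousMartingale N 𝓖 Q)
    (hy : 0 < y) (h0 : ∀ᵐ ω ∂Q, N 0 ω < y) (T : ℝ≥0) :
    ∫ ω, N 0 ω ∂Q ≤ ∫ ω, min (N T ω) y ∂Q + y * Q.real {ω | ∃ u, y ≤ N u ω} := by
  have hη : ∀ η : ℝ, 0 < η → ∫ ω, N 0 ω ∂Q ≤ ∫ ω, min (N T ω) y ∂Q
      + (y + η) * Q.real {ω | ∃ u, y ≤ N u ω} := by
    intro η hη
    set O : ℕ → Set Ω := fun n => {ω | y ≤ N 0 ω ∨ ∃ i < n,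
      η < N ((i + 1 : ℕ) * (T / n)) ω - N (i * (T / n)) ω} with hO
    have hNm : ∀ t, Measurable (N t) := fun t => (hN.measurable t).mono (𝓖.le t) le_rfl
    have hOm : ∀ n, MeasurableSet (O n) := fun n => by
      refine MeasurableSet.union (measurableSet_le measurable_const (hNm 0)) ?_
      change MeasurableSet {ω | ∃ i < n, η < N ((i + 1 : ℕ) * (T / n)) ω - N (i * (T / n)) ω}
      simp only [← exists_prop, Set.ofPred_exists]
      exact .iUnion fun i => .iUnion fun _ =>
        measurableSet_lt measurable_const ((hNm _).sub (hNm _))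
    have hO0 : Tendsto (fun n => Q (O n)) atTop (𝓝 0) := by
      have := tendsto_measure_of_ae_tendsto_indicator_of_isFiniteMeasure (μ := Q) (L := atTop)
        (A := ∅) (As := O) MeasurableSet.empty hOm (by
          filter_upwards [h0] with ω hω
          filter_upwards [eventually_forall_grid_sub_le (hN.continuous ω) T hη] with n hn
          simp only [Set.mem_empty_iff_false, iff_false, hO, Set.mem_ofPred_eq, not_or, not_exists,
            not_and, not_lt, not_le]
          exact ⟨hω, hn⟩)
      simpa using this
    have hlim := ((hN.integrable T).tendsto_setIntegral_nhds_zero hO0).const_add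
      (∫ ω, min (N T ω) y ∂Q + (y + η) * Q.real {ω | ∃ u, y ≤ N u ω})
    rw [add_zero] at hlim
    refine ge_of_tendsto hlim ?_
    filter_upwards [eventually_gt_atTop 0] with n hn
    have hnT : (n : ℝ≥0) * (T / n) = T := mul_div_cancel₀ _ (by exact_mod_cast hn.ne')
    have h := integral_le_add_overshoot (Q := Q) (ℱ := gridFiltration 𝓖 0 (T / n))
      (N := fun k ω => N (0 + k * (T / n)) ω) (fun k => hN.measurable _) (fun k => hN.integrable _)
      (fun k ω => hN.nonneg _ _) (fun j k hjk F hF => hN.setIntegral_eq _ _ (by gcongr) F hF)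
      hy.le (by positivity : 0 ≤ y + η) n
    simp only [zero_add, Nat.cast_zero, zero_mul, hnT] at h
    refine h.trans (add_le_add_left (add_le_add_right (mul_le_mul_of_nonneg_left
      (measureReal_mono ?_) (by positivity)) _) _)
    rintro ω ⟨j, -, hj⟩
    exact ⟨_, hj⟩
  have h2 : Tendsto (fun η : ℝ => ∫ ω, min (N T ω) y ∂Q
      + (y + η) * Q.real {ω | ∃ u, y ≤ N u ω}) (𝓝[>] 0)
      (𝓝 (∫ ω, min (N T ω) y ∂Q + (y + 0) * Q.real {ω | ∃ u, y ≤ N u ω})) := by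
    refine Tendsto.mono_left ?_ nhdsWithin_le_nhds
    refine Continuous.tendsto (f := fun η : ℝ => ∫ ω, min (N T ω) y ∂Q
      + (y + η) * Q.real {ω | ∃ u, y ≤ N u ω}) (by fun_prop) 0
  rw [add_zero] at h2
  refine ge_of_tendsto h2 ?_
  filter_upwards [self_mem_nhdsWithin] with η hη'
  exact hη η hη'

/-- A nonnegative continuous martingale which vanishes at infinity reaches a level `y` above its
initial value with probability `E N₀ / y`. -/
theorem IsPathContinuousMartingale.measureReal_exists_eq (hN : IsPathContinuousMartingale N 𝓖 Q)
    (hy : 0 < y) (h0 : ∀ᵐ ω ∂Q, N 0 ω < y)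
    (hlim : Tendsto (fun T : ℝ≥0 => ∫ ω, min (N T ω) y ∂Q) atTop (𝓝 0)) :
    Q.real {ω | ∃ u, y ≤ N u ω} = (∫ ω, N 0 ω ∂Q) / y := by
  rw [eq_div_iff hy.ne', mul_comm]
  refine le_antisymm (hN.mul_measureReal_exists_le hy) ?_
  have h := hlim.add_const (y * Q.real {ω | ∃ u, y ≤ N u ω})
  rw [zero_add] at h
  exact ge_of_tendsto' h fun T => hN.integral_le_add hy h0 T

end ContinuousPassage

/-! ### Exponential martingales of Brownian motion -/

section ExponentialMartingale

variable {Ω : Type*} {m : MeasurableSpace Ω} {Q : Measure Ω}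
  {𝓖 : Filtration ℝ≥0 m} {B : ℝ≥0 → Ω → ℝ}

lemma integral_exp_mul_gaussian {D : Ω → ℝ} {h : ℝ≥0} (hD : HasLaw D (gaussianReal 0 h) Q) (c : ℝ) :
    Integrable (fun ω => Real.exp (c * D ω)) Q ∧
    ∫ ω, Real.exp (c * D ω) ∂Q = Real.exp (c ^ 2 / 2 * h) := by
  constructor
  · have := integrable_exp_mul_gaussianReal (μ := 0) (v := h) c
    rw [← hD.map_eq] at this
    exact this.comp_aemeasurable hD.aemeasurable
  · have := mgf_gaussianReal hD.map_eq c
    rw [mgf] at this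
    rw [this]
    congr 1
    ring

lemma HasBrownianIncrements.hasLaw_eval (hB : HasBrownianIncrements B 𝓖 Q)
    (h0 : ∀ᵐ ω ∂Q, B 0 ω = 0) (t : ℝ≥0) : HasLaw (B t) (gaussianReal 0 t) Q := by
  refine (hB.law 0 t).congr ?_
  filter_upwards [h0] with ω hω
  simp [hω]

lemma expProcess_eq (c : ℝ) (t : ℝ≥0) (ω : Ω) :
    expProcess c B t ω = Real.exp (c * B t ω) * Real.exp (-(c ^ 2 / 2 * t)) := by
  rw [expProcess, ← Real.exp_add, sub_eq_add_neg]

lemma HasBrownianIncrements.isPathContinuousMartingale (hB : HasBrownianIncrements B 𝓖 Q)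
    (h0 : ∀ᵐ ω ∂Q, B 0 ω = 0) (hc : ∀ ω, Continuous fun t => B t ω) (c : ℝ) {x : ℝ} (hx : 0 ≤ x) :
    IsPathContinuousMartingale (fun t ω => x * expProcess c B t ω) 𝓖 Q := by
  have hm : ∀ t, Measurable[𝓖 t] (expProcess c B t) := fun t =>
    Real.measurable_exp.comp (((hB.measurable t).const_mul c).sub_const _)
  have hi : ∀ t, Integrable (expProcess c B t) Q := fun t => by
    have := (integral_exp_mul_gaussian (hB.hasLaw_eval h0 t) c).1.mul_const
      (Real.exp (-(c ^ 2 / 2 * t)))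
    exact this.congr (ae_of_all _ fun ω => (expProcess_eq c t ω).symm)
  refine ⟨fun t => (hm t).const_mul x, fun t => (hi t).const_mul x,
    fun t ω => mul_nonneg hx (expProcess_pos _ _ _ _).le, fun ω => ?_, fun s t hst F hF => ?_⟩
  · have := hc ω
    unfold expProcess
    fun_prop
  · rw [integral_const_mul, integral_const_mul]
    congr 1
    obtain ⟨h, rfl⟩ := exists_add_of_le hst
    have hFm := 𝓖.le s F hF
    set D : Ω → ℝ := fun ω => B (s + h) ω - B s ω with hD
    set ξ : Ω → ℝ := fun ω => Real.exp (c * D ω) * Real.exp (-(c ^ 2 / 2 * h)) with hξ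
    have hξm : AEStronglyMeasurable ξ Q :=
      ((integral_exp_mul_gaussian (hB.law s h) c).1.mul_const _).aestronglyMeasurable
    have hξ1 : ∫ ω, ξ ω ∂Q = 1 := by
      rw [hξ, integral_mul_const, (integral_exp_mul_gaussian (hB.law s h) c).2, ← Real.exp_add,
        add_neg_cancel, Real.exp_zero]
    have hg : Measurable[𝓖 s] (F.indicator (expProcess c B s)) := (hm s).indicator hF
    have hind : IndepFun (F.indicator (expProcess c B s)) ξ Q := by
      rw [IndepFun_iff_Indep]
      refine indep_of_indep_of_le_left (indep_of_indep_of_le_right (hB.indep s h).symm ?_)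
        hg.comap_le
      have : ξ = (fun z => Real.exp (c * z) * Real.exp (-(c ^ 2 / 2 * h))) ∘ D := rfl
      rw [this, ← MeasurableSpace.comap_comp]
      exact MeasurableSpace.comap_mono (by
        have : Measurable fun z : ℝ => Real.exp (c * z) * Real.exp (-(c ^ 2 / 2 * h)) := by fun_prop
        exact this.comap_le)
    have hprod := hind.integral_fun_mul_eq_mul_integral
      (hg.mono (𝓖.le s) le_rfl).aestronglyMeasurable hξm
    rw [hξ1, mul_one] at hprod
    rw [← integral_indicator hFm, ← integral_indicator hFm, ← hprod]
    congr 1 with ω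
    by_cases hω : ω ∈ F
    · simp only [Set.indicator_of_mem hω, hξ, hD, expProcess, ← Real.exp_add]
      congr 1
      push_cast
      ring
    · simp [Set.indicator_of_notMem hω]

/-- Since min(a, y) ≤ √(ay), the mean is controlled by that of the square root of the exponential
martingale, which is exp(-c²T/8). -/
lemma tendsto_integral_min_expProcess (hB : HasBrownianIncrements B 𝓖 Q)
    (h0 : ∀ᵐ ω ∂Q, B 0 ω = 0) {c : ℝ} (hc : c ≠ 0) {x y : ℝ} (hx : 0 ≤ x) (hy : 0 ≤ y) :
    Tendsto (fun T : ℝ≥0 => ∫ ω, min (x * expProcess c B T ω) y ∂Q) atTop (𝓝 0) := by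
  have hexp : Tendsto (fun T : ℝ≥0 => √(x * y) * Real.exp (-(c ^ 2 / 8 * T))) atTop (𝓝 0) := by
    have h1 : Tendsto (fun T : ℝ≥0 => c ^ 2 / 8 * (T : ℝ)) atTop atTop :=
      (NNReal.tendsto_coe_atTop.2 tendsto_id).const_mul_atTop (by positivity)
    simpa using (Real.tendsto_exp_neg_atTop_nhds_zero.comp h1).const_mul (√(x * y))
  refine squeeze_zero (fun T => integral_nonneg fun ω =>
    le_min (mul_nonneg hx (expProcess_pos _ _ _ _).le) hy) (fun T => ?_) hexp
  obtain ⟨i1, e1⟩ := integral_exp_mul_gaussian (hB.hasLaw_eval h0 T) (c / 2)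
  have hpt : ∀ ω, min (x * expProcess c B T ω) y
      ≤ √(x * y) * (Real.exp (c / 2 * B T ω) * Real.exp (-(c ^ 2 / 4 * T))) := fun ω => by
    have hE := expProcess_pos c B T ω
    have hsq : (Real.exp (c / 2 * B T ω) * Real.exp (-(c ^ 2 / 4 * T))) ^ 2
        = expProcess c B T ω := by
      rw [← Real.exp_add, ← Real.exp_nat_mul, expProcess]
      congr 1
      push_cast
      ring
    have h2 : √(x * y) * (Real.exp (c / 2 * B T ω) * Real.exp (-(c ^ 2 / 4 * T)))
        = √((x * expProcess c B T ω) * y) := by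
      rw [← hsq, mul_right_comm, Real.sqrt_mul (mul_nonneg hx hy), Real.sqrt_sq (by positivity)]
    rw [h2]
    apply Real.le_sqrt_of_sq_le
    have h3 : 0 ≤ min (x * expProcess c B T ω) y := le_min (mul_nonneg hx hE.le) hy
    rw [sq]
    exact mul_le_mul (min_le_left _ _) (min_le_right _ _) h3 (mul_nonneg hx hE.le)
  refine (integral_mono_of_nonneg (ae_of_all _ fun ω =>
    le_min (mul_nonneg hx (expProcess_pos _ _ _ _).le) hy) ((i1.mul_const _).const_mul _)
    (ae_of_all _ hpt)).trans (le_of_eq ?_)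
  rw [integral_const_mul, integral_mul_const, e1, ← Real.exp_add]
  congr 2
  ring

end ExponentialMartingale

/-! ### Hitting times of continuous paths and the stopped payoff -/

section Hitting

variable {Ω : Type*} {V : ℝ≥0 → Ω → ℝ} {b : ℝ} {ω : Ω}

/-- By compactness, b is reached on [0, M] as soon as every level b - 1/(k+1) is exceeded there, and
strict excesses are visible on a countable dense set of times. -/
lemma measurableSet_exists_le [MeasurableSpace Ω] (hm : ∀ t, Measurable (V t))
    (hc : ∀ ω, Continuous fun t => V t ω) (b : ℝ) : MeasurableSet {ω | ∃ u, b ≤ V u ω} := by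
  obtain ⟨D, hDc, hDd⟩ := TopologicalSpace.exists_countable_dense ℝ≥0
  have : {ω | ∃ u, b ≤ V u ω} = ⋃ M : ℕ, ⋂ k : ℕ, ⋃ q ∈ D, ⋃ (_ : q < (M : ℝ≥0)),
      {ω | b - 1 / ((k : ℝ) + 1) < V q ω} := by
    ext ω
    simp only [Set.mem_ofPred_eq, Set.mem_iUnion, Set.mem_iInter, exists_prop]
    constructor
    · rintro ⟨u, hu⟩
      obtain ⟨M, hM⟩ := exists_nat_gt u
      refine ⟨M, fun k => ?_⟩
      have ho : IsOpen {q : ℝ≥0 | b - 1 / ((k : ℝ) + 1) < V q ω ∧ q < M} :=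
        (isOpen_lt continuous_const (hc ω)).inter isOpen_Iio
      obtain ⟨q, ⟨h1, h2⟩, h3⟩ := hDd.inter_open_nonempty _ ho
        ⟨u, lt_of_lt_of_le (sub_lt_self _ Nat.one_div_pos_of_nat) hu, hM⟩
      exact ⟨q, h3, h2, h1⟩
    · rintro ⟨M, hM⟩
      obtain ⟨u, -, hu⟩ := (isCompact_Icc (a := (0 : ℝ≥0)) (b := M)).exists_isMaxOn
        ⟨0, le_rfl, zero_le⟩ (hc ω).continuousOn
      refine ⟨u, le_of_forall_pos_lt_add fun ε hε => ?_⟩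
      obtain ⟨k, hk⟩ := exists_nat_one_div_lt hε
      obtain ⟨q, -, h2, h3⟩ := hM k
      have h4 : V q ω ≤ V u ω := hu ⟨zero_le, h2.le⟩
      linarith
  rw [this]
  exact .iUnion fun M => .iInter fun k => .biUnion hDc fun q _ => .iUnion fun _ =>
    measurableSet_lt measurable_const (hm q)

lemma hittingAfter_zero_lt_top_iff (s : Set ℝ) :
    hittingAfter V s 0 ω < ⊤ ↔ ∃ u, V u ω ∈ s := by
  classical
  rw [hittingAfter_def]
  simp only [zero_le, true_and]
  split_ifs with h
  · exact ⟨fun _ => h, fun _ => WithTop.coe_lt_top _⟩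
  · simpa using h

lemma exists_hittingAfter_eq_coe (hc : Continuous fun t => V t ω) {s : Set ℝ} (hs : IsClosed s)
    (h : ∃ u, V u ω ∈ s) :
    ∃ t : ℝ≥0, hittingAfter V s 0 ω = t ∧ V t ω ∈ s ∧ ∀ u, V u ω ∈ s → t ≤ u := by
  classical
  refine ⟨sInf {i | 0 ≤ i ∧ V i ω ∈ s}, ?_, ?_, fun u hu => csInf_le' ⟨zero_le, hu⟩⟩
  · rw [hittingAfter_def]
    simp only [zero_le, true_and, h, if_true]
  · have hcl : IsClosed {i | 0 ≤ i ∧ V i ω ∈ s} := isClosed_Ici.inter (hs.preimage hc)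
    exact (hcl.csInf_mem ⟨h.choose, zero_le, h.choose_spec⟩ (OrderBot.bddBelow _)).2

lemma exists_eq_of_le (hc : Continuous fun t => V t ω) (h0 : V 0 ω < b) {t : ℝ≥0} (ht : b ≤ V t ω) :
    ∃ u ≤ t, V u ω = b := by
  obtain ⟨u, hu, h⟩ := intermediate_value_Icc (zero_le : (0 : ℝ≥0) ≤ t) hc.continuousOn ⟨h0.le, ht⟩
  exact ⟨u, hu.2, h⟩

/-- With the loan rate equal to r the discount factors cancel, and the payoff depends on time only
through V. -/
lemma discountedPayoff_self (r L : ℝ) (t : ℝ≥0) :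
    discountedPayoff r r L V t ω = max (V t ω - L) 0 := by
  have h : max (Real.exp (r * t) * V t ω - Real.exp (r * t) * L) 0
      = Real.exp (r * t) * max (V t ω - L) 0 := by
    rw [mul_max_of_nonneg _ _ (Real.exp_pos _).le, mul_zero, mul_sub]
  rw [discountedPayoff, h, ← mul_assoc, ← Real.exp_add, neg_mul, neg_add_cancel, Real.exp_zero,
    one_mul]

lemma stoppedValue_of_eq_coe {u : ℝ≥0 → Ω → ℝ} {τ : Ω → WithTop ℝ≥0} {t : ℝ≥0} (h : τ ω = t) :
    stoppedValue u τ ω = u t ω := by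
  rw [stoppedValue, h]
  rfl

lemma repaymentTime_lt_top_iff : repaymentTime V b ω < ⊤ ↔ ∃ u, b ≤ V u ω :=
  hittingAfter_zero_lt_top_iff _

/-- Repaying at the first passage of a level `b > L` from below yields `b - L`. -/
lemma stoppedValue_repaymentTime_of_lt (hc : Continuous fun t => V t ω) (h0 : V 0 ω < b) {L : ℝ}
    (hL : L < b) (r : ℝ) (hτ : repaymentTime V b ω < ⊤) :
    stoppedValue (discountedPayoff r r L V) (repaymentTime V b) ω = b - L := by
  obtain ⟨t, ht, hmem, hmin⟩ := exists_hittingAfter_eq_coe hc isClosed_Ici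
    ((hittingAfter_zero_lt_top_iff _).1 hτ)
  obtain ⟨u, hut, hu⟩ := exists_eq_of_le hc h0 hmem
  -- Starting below b, a continuous path enters [b, ∞) exactly at b.
  have hVt : V t ω = b := by
    rw [le_antisymm (hmin u (by simp [hu])) hut, hu]
  rw [stoppedValue_of_eq_coe (τ := repaymentTime V b) ht, discountedPayoff_self, hVt, max_eq_left (by linarith)]

lemma stoppedValue_repaymentTime_of_le (hc : Continuous fun t => V t ω) (h0 : b ≤ V 0 ω) {L : ℝ}
    (hL : L < b) (r : ℝ) :
    stoppedValue (discountedPayoff r r L V) (repaymentTime V b) ω = V 0 ω - L := by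
  obtain ⟨t, ht, -, hmin⟩ := exists_hittingAfter_eq_coe hc isClosed_Ici ⟨0, h0⟩
  obtain rfl : t = 0 := le_antisymm (hmin 0 h0) zero_le
  rw [stoppedValue_of_eq_coe (τ := repaymentTime V b) ht, discountedPayoff_self, max_eq_left (by linarith)]

end Hitting

section ConstantPayoff

variable {Ω : Type*} [MeasurableSpace Ω] {Q : Measure Ω} [IsFiniteMeasure Q]

lemma setIntegral_eq_const_mul {f : Ω → ℝ} {E : Set Ω} (hE : MeasurableSet E) {κ : ℝ}
    (h : ∀ᵐ ω ∂Q, ω ∈ E → f ω = κ) : IntegrableOn f E Q ∧ ∫ ω in E, f ω ∂Q = κ * Q.real E := by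
  have h' : f =ᵐ[Q.restrict E] fun _ => κ := (ae_restrict_iff' hE).2 h
  refine ⟨(integrable_const κ).congr h'.symm, ?_⟩
  rw [integral_congr_ae h', setIntegral_const, smul_eq_mul, mul_comm]

end ConstantPayoff

/-! ### Passing to a smaller filtration -/

section Filtrations

variable {Ω : Type*} {m : MeasurableSpace Ω} {Q : Measure Ω} {𝓕 𝓖 : Filtration ℝ≥0 m}

/-- The tower property. It permits working in the filtration of the single driving process W, for
which its increments are independent of the past. -/
lemma MeasureTheory.Martingale.of_filtration_le {N : ℝ≥0 → Ω → ℝ} (hN : Martingale N 𝓕 Q)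
    [IsFiniteMeasure Q] (hle : ∀ t, 𝓖 t ≤ 𝓕 t) (hm : StronglyAdapted 𝓖 N) : Martingale N 𝓖 Q := by
  refine ⟨hm, fun i j hij => ?_⟩
  have h1 : Q[Q[N j | 𝓕 i] | 𝓖 i] =ᵐ[Q] Q[N j | 𝓖 i] := condExp_condExp_of_le (hle i) (𝓕.le i)
  have h2 : Q[Q[N j | 𝓕 i] | 𝓖 i] =ᵐ[Q] Q[N i | 𝓖 i] := condExp_congr_ae (hN.condExp_ae_eq hij)
  refine h1.symm.trans (h2.trans ?_)
  rw [condExp_of_stronglyMeasurable (𝓖.le i) (hm i) (hN.integrable i)]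

end Filtrations

/-! ### Passage of geometric Brownian motion -/

section GeometricBrownianMotion

variable {Ω : Type*} {m : MeasurableSpace Ω} {P Q : Measure Ω} {𝓖 : Filtration ℝ≥0 m}
  {B : ℝ≥0 → Ω → ℝ}

/-- The passage probability of a level `b` above the initial value by a geometric Brownian motion
with drift `-δ > -σ² / 2`. -/
lemma HasBrownianIncrements.measureReal_exists_le_geometricBM [IsProbabilityMeasure Q]
    (hB : HasBrownianIncrements B 𝓖 Q) (h0 : ∀ᵐ ω ∂Q, B 0 ω = 0)
    (hc : ∀ ω, Continuous fun t => B t ω) {v b δ σ β : ℝ} (hv : 0 < v) (hvb : v < b) (hσ : 0 < σ)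
    (hβ : 0 < β) (hβδ : β = 1 + 2 * δ / σ ^ 2) :
    Q.real {ω | ∃ u, b ≤ geometricBM v (-δ) σ B u ω} = (v / b) ^ β := by
  have hb : 0 < b := hv.trans hvb
  -- Since δ + σ²/2 = βσ²/2, the drift term of log V times β is -(βσ)²/2, exactly the compensator of
  -- βσB.
  have hpow : ∀ t ω, geometricBM v (-δ) σ B t ω ^ β = v ^ β * expProcess (β * σ) B t ω := by
    intro t ω
    rw [geometricBM, Real.mul_rpow hv.le (Real.exp_pos _).le, ← Real.exp_mul, expProcess]
    congr 2
    have : δ = (β - 1) * σ ^ 2 / 2 := by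
      rw [hβδ]
      field_simp
      ring
    rw [this]
    ring
  have hset : {ω | ∃ u, b ≤ geometricBM v (-δ) σ B u ω}
      = {ω | ∃ u, b ^ β ≤ v ^ β * expProcess (β * σ) B u ω} := by
    ext ω
    refine exists_congr fun u => ?_
    have hpos : 0 < geometricBM v (-δ) σ B u ω := mul_pos hv (Real.exp_pos _)
    rw [← hpow, Real.rpow_le_rpow_iff hb.le hpos.le hβ]
  have hvβ : 0 < v ^ β := Real.rpow_pos_of_pos hv β
  have hstart : ∀ᵐ ω ∂Q, v ^ β * expProcess (β * σ) B 0 ω = v ^ β := by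
    filter_upwards [h0] with ω hω
    simp [expProcess, hω]
  rw [hset, (hB.isPathContinuousMartingale h0 hc (β * σ) hvβ.le).measureReal_exists_eq
    (Real.rpow_pos_of_pos hb β) ?_ (tendsto_integral_min_expProcess hB h0 (by positivity) hvβ.le
      (Real.rpow_nonneg hb.le β)), integral_congr_ae hstart, integral_const, probReal_univ,
    one_smul, Real.div_rpow hv.le hb.le]
  filter_upwards [hstart] with ω hω
  rw [hω]
  exact Real.rpow_lt_rpow hv.le hvb hβ

lemma trim_absolutelyContinuous_of_le {m₁ m₂ : MeasurableSpace Ω} (h₁₂ : m₁ ≤ m₂) (h₂ : m₂ ≤ m)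
    (h : Q.trim h₂ ≪ P.trim h₂) : Q.trim (h₁₂.trans h₂) ≪ P.trim (h₁₂.trans h₂) := by
  refine Measure.AbsolutelyContinuous.mk fun s hs hP => ?_
  rw [trim_measurableSet_eq _ hs] at hP ⊢
  rw [← trim_measurableSet_eq h₂ (h₁₂ s hs)] at hP ⊢
  exact h hP

lemma ae_of_ae_of_trim_absolutelyContinuous {m₁ : MeasurableSpace Ω} (h₁ : m₁ ≤ m)
    (h : Q.trim h₁ ≪ P.trim h₁) {f : Ω → ℝ} (hf : Measurable[m₁] f) {x : ℝ}
    (hP : ∀ᵐ ω ∂P, f ω = x) : ∀ᵐ ω ∂Q, f ω = x := by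
  have hs : MeasurableSet[m₁] {ω | f ω = x}ᶜ := (hf (measurableSet_singleton x)).compl
  have hP' : P.trim h₁ {ω | f ω = x}ᶜ = 0 := by rwa [trim_measurableSet_eq _ hs]
  have := h hP'
  rwa [trim_measurableSet_eq _ hs] at this

end GeometricBrownianMotion

/-! ### The driving Brownian motion under Q -/

section RiskNeutral

variable {Ω : Type*} [MeasurableSpace Ω] {P Q : Measure Ω} [IsProbabilityMeasure P]
  {W₁ W₂ : ℝ≥0 → Ω → ℝ}

/-- Under a risk-neutral measure, the Brownian motion which drives `V`, corrected by the market
price of risk, is a Brownian motion for its own filtration. -/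
lemma IsRiskNeutral.hasBrownianIncrements (hW : IsStandardBrownianPair W₁ W₂ P)
    {S V : ℝ≥0 → Ω → ℝ} {κ σ ρ δ v : ℝ} (hσ : 0 < σ) (hρ : |ρ| < 1) (hv : 0 < v)
    (hV : V = geometricBM v κ σ (fun t ω => ρ * W₁ t ω + √(1 - ρ ^ 2) * W₂ t ω))
    (hQ : IsRiskNeutral (pairFiltration W₁ W₂ hW.measurable₁ hW.measurable₂) P Q S V δ) :
    ∃ (𝓖 : Filtration ℝ≥0 ‹MeasurableSpace Ω›) (B : ℝ≥0 → Ω → ℝ), HasBrownianIncrements B 𝓖 Q ∧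
      (∀ᵐ ω ∂Q, B 0 ω = 0) ∧ (∀ ω, Continuous fun t => B t ω) ∧ V = geometricBM v (-δ) σ B := by
  have := hQ.isProbabilityMeasure
  set a : ℝ := √(1 - ρ ^ 2) with ha
  have hρ2 : ρ ^ 2 < 1 := (sq_lt_one_iff_abs_lt_one ρ).2 hρ
  have hab : ρ ^ 2 + a ^ 2 = 1 := by
    rw [ha, Real.sq_sqrt (by linarith)]
    ring
  set W : ℝ≥0 → Ω → ℝ := fun t ω => ρ * W₁ t ω + a * W₂ t ω with hWdef
  have hWm : ∀ t, Measurable (W t) := fun t =>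
    ((hW.measurable₁ t).const_mul ρ).add ((hW.measurable₂ t).const_mul a)
  have hWc : ∀ ω, Continuous fun t => W t ω := fun ω =>
    (continuous_const.mul (hW.continuous₁ ω)).add (continuous_const.mul (hW.continuous₂ ω))
  have hWP : IsPreBrownianReal W P := IsPreBrownianReal.linearCombination
    hW.brownian₁.toIsPreBrownianReal hW.brownian₂.toIsPreBrownianReal hW.indep hab
  have hWi := IsPreBrownianReal.hasBrownianIncrements hWP hWm
  set 𝓕 := pairFiltration W₁ W₂ hW.measurable₁ hW.measurable₂ with h𝓕
  set 𝓖 := Filtration.natural W fun t => (hWm t).stronglyMeasurable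
  have hpair : ∀ t, Measurable[𝓕 t] fun ω => (W₁ t ω, W₂ t ω) := fun t =>
    (Filtration.stronglyAdapted_natural (u := fun t ω => (W₁ t ω, W₂ t ω))
      (fun t => ((hW.measurable₁ t).prodMk (hW.measurable₂ t)).stronglyMeasurable) t).measurable
  have hW𝓕 : ∀ t, Measurable[𝓕 t] (W t) := fun t =>
    ((measurable_fst.comp (hpair t)).const_mul ρ).add
      ((measurable_snd.comp (hpair t)).const_mul a)
  have hle : ∀ t, 𝓖 t ≤ 𝓕 t := fun t => iSup₂_le fun j hj =>
    ((hW𝓕 j).mono (𝓕.mono hj) le_rfl).comap_le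
  have hac : ∀ t, Q.trim (𝓖.le t) ≪ P.trim (𝓖.le t) := fun t =>
    trim_absolutelyContinuous_of_le (hle t) (𝓕.le t) (hQ.absolutelyContinuous t)
  -- The drift (κ + δ)/σ is the one for which e^{δt}V_t / v = exp(σB_t - σ²t/2).
  set B : ℝ≥0 → Ω → ℝ := fun t ω => W t ω + (κ + δ) / σ * t with hBdef
  have hBc : ∀ ω, Continuous fun t => B t ω := fun ω =>
    (hWc ω).add (continuous_const.mul NNReal.continuous_coe)
  have hVB : V = geometricBM v (-δ) σ B := by
    rw [hV]
    funext t ω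
    simp only [geometricBM, hBdef]
    congr 2
    field_simp
    ring
  have hN : Martingale (expProcess σ B) 𝓕 Q := by
    have h1 := hQ.martingale_snd.smul v⁻¹
    convert h1 using 1
    funext t ω
    simp only [hVB, geometricBM, Pi.smul_apply, smul_eq_mul, expProcess]
    rw [mul_left_comm (Real.exp _), inv_mul_cancel_left₀ hv.ne', ← Real.exp_add]
    congr 1
    ring
  have hN' : Martingale (expProcess σ B) 𝓖 Q := hN.of_filtration_le hle fun t =>
    (Real.measurable_exp.comp
      ((((hWi.measurable t).add_const _).const_mul σ).sub_const _)).stronglyMeasurable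
  refine ⟨𝓖, B, HasBrownianIncrements.of_martingale_expProcess hWi (fun t ω => rfl) hBc hac hσ hN',
    ?_, hBc, hVB⟩
  have hB0 : B 0 = W 0 := by
    funext ω
    simp [hBdef]
  rw [hB0]
  exact ae_of_ae_of_trim_absolutelyContinuous (𝓖.le 0) (hac 0) (hWi.measurable 0)
    hWP.eval_zero_ae_eq_zero

end RiskNeutral

lemma repaymentExponent_eq {r μ₁ μ₂ σ₁ σ₂ ρ δ : ℝ} (hσ₂ : 0 < σ₂)
    (hCAPM : (μ₂ + δ - r) / σ₂ = ρ * ((μ₁ - r) / σ₁)) :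
    repaymentExponent r μ₁ μ₂ σ₁ σ₂ ρ = 1 + 2 * δ / σ₂ ^ 2 := by
  rw [repaymentExponent, ← hCAPM]
  field_simp
  ring

/-! ### The cost of the repayment option -/

section RepaymentOption

variable {Ω : Type*} [MeasurableSpace Ω] {Q : Measure Ω} {V : ℝ≥0 → Ω → ℝ}
  {v b L : ℝ}

/-- From a start below b, the intermediate value theorem makes reaching [b, ∞) and hitting b the
same event. -/
lemma measureReal_hittingAfter_singleton (hc : ∀ ω, Continuous fun t => V t ω)
    (h0 : ∀ᵐ ω ∂Q, V 0 ω = v) (hvb : v < b) :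
    Q.real {ω | hittingAfter V {b} 0 ω < ⊤} = Q.real {ω | ∃ u, b ≤ V u ω} := by
  refine measureReal_congr ?_
  filter_upwards [h0] with ω hω
  refine propext ((hittingAfter_zero_lt_top_iff _).trans ⟨?_, ?_⟩)
  · rintro ⟨u, hu⟩
    exact ⟨u, (Set.mem_singleton_iff.1 hu).ge⟩
  · rintro ⟨u, hu⟩
    obtain ⟨w, -, hw⟩ := exists_eq_of_le (hc ω) (hω ▸ hvb) hu
    exact ⟨w, hw⟩

variable [IsProbabilityMeasure Q]

lemma repaymentOptionCost_of_lt (hm : ∀ t, Measurable (V t))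
    (hc : ∀ ω, Continuous fun t => V t ω) (h0 : ∀ᵐ ω ∂Q, V 0 ω = v) (hL : L < b) (r : ℝ)
    (hvb : v < b) :
    IntegrableOn (stoppedValue (discountedPayoff r r L V) (repaymentTime V b))
      {ω | repaymentTime V b ω < ⊤} Q ∧
    repaymentOptionCost Q r r L V (repaymentTime V b)
      = (b - L) * Q.real {ω | ∃ u, b ≤ V u ω} := by
  have hset : {ω | repaymentTime V b ω < ⊤} = {ω | ∃ u, b ≤ V u ω} :=
    Set.ext fun ω => repaymentTime_lt_top_iff
  rw [repaymentOptionCost, hset]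
  refine setIntegral_eq_const_mul (measurableSet_exists_le hm hc b) ?_
  filter_upwards [h0] with ω hω hE
  exact stoppedValue_repaymentTime_of_lt (hc ω) (hω ▸ hvb) hL r (repaymentTime_lt_top_iff.2 hE)

lemma repaymentOptionCost_of_le (hm : ∀ t, Measurable (V t))
    (hc : ∀ ω, Continuous fun t => V t ω) (h0 : ∀ᵐ ω ∂Q, V 0 ω = v) (hL : L < b) (r : ℝ)
    (hbv : b ≤ v) :
    IntegrableOn (stoppedValue (discountedPayoff r r L V) (repaymentTime V b))
      {ω | repaymentTime V b ω < ⊤} Q ∧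
    repaymentOptionCost Q r r L V (repaymentTime V b) = v - L := by
  have hset : {ω | repaymentTime V b ω < ⊤} = {ω | ∃ u, b ≤ V u ω} :=
    Set.ext fun ω => repaymentTime_lt_top_iff
  have hfull : Q.real {ω | ∃ u, b ≤ V u ω} = 1 := by
    rw [← probReal_univ (μ := Q)]
    refine measureReal_congr ?_
    filter_upwards [h0] with ω hω
    exact propext ⟨fun _ => trivial, fun _ => ⟨0, hω ▸ hbv⟩⟩
  rw [repaymentOptionCost, hset]
  have h := setIntegral_eq_const_mul (Q := Q) (κ := v - L)
    (f := stoppedValue (discountedPayoff r r L V) (repaymentTime V b))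
    (measurableSet_exists_le hm hc b) (by
      filter_upwards [h0] with ω hω _
      rw [stoppedValue_repaymentTime_of_le (hc ω) (hω ▸ hbv) hL r, hω])
  rwa [hfull, mul_one] at h

end RepaymentOption

theorem mainTheorem1 {Ω : Type*} [MeasurableSpace Ω] (P Q : Measure Ω) [IsProbabilityMeasure P]
    (W₁ W₂ : ℝ≥0 → Ω → ℝ) (hW : IsStandardBrownianPair W₁ W₂ P)
    (r α μ₁ μ₂ σ₁ σ₂ ρ δ γ L s₀ v b : ℝ)
    (hσ₁ : 0 < σ₁) (hσ₂ : 0 < σ₂) (hρ : |ρ| < 1) (hγ : 0 < γ) (hL : 0 < L)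
    (hs₀ : 0 < s₀) (hv : 0 < v) (hδ : -(σ₂ ^ 2 / 2) < δ)
    (hα : α = r)
    (hCAPM : (μ₂ + δ - r) / σ₂ = ρ * ((μ₁ - r) / σ₁))
    (S V : ℝ≥0 → Ω → ℝ)
    (hS : S = geometricBM s₀ (μ₁ - r) σ₁ W₁)
    (hV : V = geometricBM v (μ₂ - r) σ₂ (fun t ω => ρ * W₁ t ω + √(1 - ρ ^ 2) * W₂ t ω))
    (hQ : IsRiskNeutral (pairFiltration W₁ W₂ hW.measurable₁ hW.measurable₂) P Q S V δ)
    (β : ℝ) (hβ : β = repaymentExponent r μ₁ μ₂ σ₁ σ₂ ρ)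
    (hb : IsRepaymentThreshold L γ ρ β b) :
    (β = 1 + 2 * δ / σ₂ ^ 2 ∧ 0 < β) ∧
    (∃ WQ : ℝ≥0 → Ω → ℝ, IsBrownianReal WQ Q ∧ V = geometricBM v (-δ) σ₂ WQ) ∧
    IntegrableOn (stoppedValue (discountedPayoff r α L V) (repaymentTime V b))
      {ω | repaymentTime V b ω < ⊤} Q ∧
    (v < b →
      repaymentOptionCost Q r α L V (repaymentTime V b)
          = (b - L) * Q.real {ω | hittingAfter V {b} 0 ω < ⊤} ∧
      Q.real {ω | hittingAfter V {b} 0 ω < ⊤} = (v / b) ^ β ∧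
      repaymentOptionCost Q r α L V (repaymentTime V b) = (b - L) * (v / b) ^ β) ∧
    (b ≤ v → repaymentOptionCost Q r α L V (repaymentTime V b) = v - L) := by
  subst hα
  have := hQ.isProbabilityMeasure
  have hβδ : β = 1 + 2 * δ / σ₂ ^ 2 := hβ.trans (repaymentExponent_eq hσ₂ hCAPM)
  have hβ0 : 0 < β := by
    -- The bound δ > -σ₂²/2 is precisely positivity of β.
    have h1 : -1 < 2 * δ / σ₂ ^ 2 := by
      rw [lt_div_iff₀ (by positivity)]
      linarith
    linarith
  obtain ⟨𝓖, B, hB, hB0, hBc, hVB⟩ := hQ.hasBrownianIncrements hW hσ₂ hρ hv hV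
  have hm : ∀ t, Measurable (V t) := fun t => by
    have := (hB.measurable t).mono (𝓖.le t) le_rfl
    rw [hVB]
    unfold geometricBM
    fun_prop
  have hc : ∀ ω, Continuous fun t => V t ω := fun ω => by
    have := hBc ω
    rw [hVB]
    unfold geometricBM
    fun_prop
  have hV0 : ∀ᵐ ω ∂Q, V 0 ω = v := by
    filter_upwards [hB0] with ω hω
    simp [hVB, geometricBM, hω]
  have hhit : v < b → Q.real {ω | ∃ u, b ≤ V u ω} = (v / b) ^ β := fun hvb => by
    rw [hVB]
    exact hB.measureReal_exists_le_geometricBM hB0 hBc hv hvb hσ₂ hβ0 hβδ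
  refine ⟨⟨hβδ, hβ0⟩, ⟨B, ⟨hB.isPreBrownianReal hB0, ae_of_all _ hBc⟩, hVB⟩, ?_, fun hvb => ?_,
    fun hbv => (repaymentOptionCost_of_le hm hc hV0 hb.1 _ hbv).2⟩
  · rcases lt_or_ge v b with hvb | hbv
    · exact (repaymentOptionCost_of_lt hm hc hV0 hb.1 _ hvb).1
    · exact (repaymentOptionCost_of_le hm hc hV0 hb.1 _ hbv).1
  · have hcost := (repaymentOptionCost_of_lt hm hc hV0 hb.1 α hvb).2
    rw [measureReal_hittingAfter_singleton hc hV0 hvb]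
    exact ⟨hcost, hhit hvb, by rw [hcost, hhit hvb]⟩
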